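/- Let $K$ be a commutative ring containing $\mathbb{Q}$ and let $\Lambda = K[p_1,p_2,\dots]$ be the ring of symmetric functions over $K$, with Schur functions $s_\lambda$ and plethysm $f[g]$. For a partition $\lambda$, with conjugate $\lambda'$, let $d(\lambda)$ be the largest $i$ such that $(i,i)$ is a cell of $\lambda$ ($d(\lambda)=0$ if $\lambda$ is empty). A corner of $\lambda$ is a cell $(r,c)$ of $\lambda$ such that neither $(r+1,c)$ nor $(r,c+1)$ is a cell of $\lambda$; let $b_\lambda$ be the number of corners of $\lambda$. Call $\lambda$ threshold if $\lambda'_i=\lambda_i+1$ for all $1\le i\le d(\lambda)$. Then for every integer $h\ge 2$, \begin{align*} s_{(2,1^{h-2})}[s_{1^2}] &= \sum_{\mu \in \mathcal{T}_{2h}} s_\mu + \sum_{\nu \vdash 2h \text{ threshold}} \left\lfloor \frac{b_{\nu}-1}{2} \right\rfloor s_\nu,\\ s_{(2,1^{h-2})}[s_{2}] &= \sum_{\mu \in \mathcal{T}_{2h}} s_{\mu'} + \sum_{\nu \vdash 2h \text{ threshold}} \left\lfloor \frac{b_{\nu}-1}{2} \right\rfloor s_{\nu'}, \end{align*} where $\mathcal{T}_{2h}$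 is the set of all partitions $\lambda$ of $2h$ such that $\lambda'_i=\lambda_i+1$ for all $1\le i\le d(\lambda)$ except either (i) for exactly two distinct $i$ in the range $1\le i\le d(\lambda)$, for each of which either $\lambda'_i=\lambda_i+2$ and the cell $(\lambda'_i,i)$ is a corner of $\lambda$, or $\lambda'_i=\lambda_i$; or (ii) for exactly one $i$ in the range $1\le i\le d(\lambda)$, for which $\lambda'_i=\lambda_i+3$. -/

import Mathlib

/-! ## The ring of symmetric functions and plethysm -/

/-- The ring of symmetric functions `Λ = K[p₁, p₂, p₃, …]`: the polynomial ring over `K` in the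
power sums, where the variable `X r` (for a positive integer `r`) is the power sum `p_r`. -/
abbrev SymFun (K : Type*) [CommRing K] : Type _ := MvPolynomial ℕ+ K

namespace SymFun

/-- The complete homogeneous symmetric functions `h_n`, given in terms of the power sums by
`h_0 = 1` and `n h_n = p_1 h_{n-1} + p_2 h_{n-2} + ⋯ + p_n h_0`, that is,
`∑ h_n tⁿ = exp (∑ p_r t^r / r)`. -/
noncomputable def complete (K : Type*) [CommRing K] [Algebra ℚ K] : ℕ → SymFun K
  | 0 => 1
  | n + 1 => ((n : ℚ) + 1)⁻¹ •
      ∑ i : Fin (n + 1), MvPolynomial.X (Nat.succPNat i) * complete K (n - i)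
decreasing_by omega

/-- The Schur function `s_μ = det (h_{μ_i - i + j})`, where `i, j` range over the rows of `μ`,
and `h_m = 0` for `m < 0`. -/
noncomputable def schur (K : Type*) [CommRing K] [Algebra ℚ K] (μ : YoungDiagram) : SymFun K :=
  Matrix.det (Matrix.of fun i j : Fin (μ.colLen 0) =>
    if (i : ℕ) ≤ μ.rowLen i + j then complete K (μ.rowLen i + j - i) else 0)

/-- `p_r[g]` for `g` with rational coefficients: every power sum `p_k` in `g` is replaced
by `p_{r k}`. -/
noncomputable def powerPlethysm (r : ℕ+) (g : SymFun ℚ) : SymFun ℚ :=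
  MvPolynomial.rename (fun k => r * k) g

/-- The plethysm `f[g]`, for `f` over `K` and `g` with rational coefficients: every power sum
`p_r` in `f` is replaced by `p_r[g]`. -/
noncomputable def plethysm {K : Type*} [CommRing K] [Algebra ℚ K]
    (f : SymFun K) (g : SymFun ℚ) : SymFun K :=
  MvPolynomial.aeval
    (fun r : ℕ+ => MvPolynomial.map (algebraMap ℚ K) (powerPlethysm r g)) f

end SymFun

/-! ## Partitions

Partitions are Young diagrams in English notation. Rows and columns are numbered from `0`:
`λ_{i+1} = μ.rowLen i` and `λ'_{i+1} = μ.colLen i`. The condition `i + 1 ≤ d(λ)`, where `d(λ)` is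
the length of the main diagonal, is `(i, i) ∈ μ`. -/

namespace YoungDiagram

theorem finite_card_eq (n : ℕ) : {μ : YoungDiagram | μ.card = n}.Finite := by
  refine Set.Finite.of_finite_image (f := YoungDiagram.cells) ?_
    (fun μ _ ν _ h => YoungDiagram.ext h)
  refine (Finset.finite_toSet (Finset.range n ×ˢ Finset.range n).powerset).subset ?_
  rintro _ ⟨μ, rfl, rfl⟩
  simp only [Finset.coe_powerset, Set.mem_preimage, Set.mem_powerset_iff, Finset.coe_subset]
  rintro ⟨i, j⟩ hc
  have h1 : (Finset.range (i + 1)).image (fun k => (k, j)) ⊆ μ.cells := by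
    intro c hc'
    obtain ⟨k, hk, rfl⟩ := Finset.mem_image.1 hc'
    exact μ.up_left_mem (Nat.lt_succ_iff.1 (Finset.mem_range.1 hk)) le_rfl hc
  have h2 : (Finset.range (j + 1)).image (fun k => (i, k)) ⊆ μ.cells := by
    intro c hc'
    obtain ⟨k, hk, rfl⟩ := Finset.mem_image.1 hc'
    exact μ.up_left_mem le_rfl (Nat.lt_succ_iff.1 (Finset.mem_range.1 hk)) hc
  have h1' := Finset.card_le_card h1
  have h2' := Finset.card_le_card h2
  rw [Finset.card_image_of_injective _ (fun a b h => (Prod.mk.inj h).1),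
    Finset.card_range] at h1'
  rw [Finset.card_image_of_injective _ (fun a b h => (Prod.mk.inj h).2),
    Finset.card_range] at h2'
  simp only [Finset.mem_product, Finset.mem_range, YoungDiagram.card]
  omega

/-- The finite set of all partitions of `n`. -/
noncomputable def partitionsOf (n : ℕ) : Finset YoungDiagram := (finite_card_eq n).toFinset

/-- The column `(1, 1) = (1²)`. -/
def colTwo : YoungDiagram := ofRowLens [1, 1] (List.Pairwise.sortedGE (by simp))

/-- The row `(2)`. -/
def rowTwo : YoungDiagram := ofRowLens [2] (List.Pairwise.sortedGE (by simp))

/-- The partition `(2, 1^k) = (2, 1, …, 1)` with `k` ones. -/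
def twoOnes (k : ℕ) : YoungDiagram :=
  ofRowLens (2 :: List.replicate k 1)
    (List.Pairwise.sortedGE (by simp [List.pairwise_replicate]))

/-- A corner of `μ` is a cell of `μ` with no cell of `μ` directly below it or directly to its
right. -/
def IsCorner (μ : YoungDiagram) (c : ℕ × ℕ) : Prop :=
  c ∈ μ ∧ (c.1 + 1, c.2) ∉ μ ∧ (c.1, c.2 + 1) ∉ μ

open Classical in
/-- The number `b_μ` of corners of `μ`. -/
noncomputable def numCorners (μ : YoungDiagram) : ℕ := (μ.cells.filter μ.IsCorner).card

/-- `μ` is threshold: `λ'_i = λ_i + 1` for all `1 ≤ i ≤ d(λ)`. -/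
def IsThreshold (μ : YoungDiagram) : Prop :=
  ∀ i, (i, i) ∈ μ → μ.colLen i = μ.rowLen i + 1

/-- The defect allowed at two places of the diagonal: either `λ'_i = λ_i + 2` and the bottom cell
of column `i` is a corner, or `λ'_i = λ_i`. -/
def SmallDefect (μ : YoungDiagram) (i : ℕ) : Prop :=
  (μ.colLen i = μ.rowLen i + 2 ∧ μ.IsCorner (μ.colLen i - 1, i)) ∨ μ.colLen i = μ.rowLen i

/-- `λ'_i = λ_i + 1` for all `1 ≤ i ≤ d(λ)`, except either for two distinct `i`, each of which has
a small defect, or for one `i`, for which `λ'_i = λ_i + 3`. -/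
def IsNearThreshold (μ : YoungDiagram) : Prop :=
  (∃ i j, i ≠ j ∧ (i, i) ∈ μ ∧ (j, j) ∈ μ ∧ μ.SmallDefect i ∧ μ.SmallDefect j ∧
    ∀ k, (k, k) ∈ μ → k ≠ i → k ≠ j → μ.colLen k = μ.rowLen k + 1) ∨
  (∃ i, (i, i) ∈ μ ∧ μ.colLen i = μ.rowLen i + 3 ∧
    ∀ k, (k, k) ∈ μ → k ≠ i → μ.colLen k = μ.rowLen k + 1)

open Classical in
/-- The set of threshold partitions of `n`. -/
noncomputable def thresholdPartitions (n : ℕ) : Finset YoungDiagram :=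
  (partitionsOf n).filter IsThreshold

open Classical in
/-- The set `𝒯_n` of near-threshold partitions of `n`. -/
noncomputable def nearThresholdPartitions (n : ℕ) : Finset YoungDiagram :=
  (partitionsOf n).filter IsNearThreshold

end YoungDiagram

/-! The proof rests on s_{(2,1^{h-2})} = e_{h-1} e_1 - e_h (`schur_twoOnes`). Since plethysm by a
fixed g is a ring homomorphism, the left side of the first identity is e_2 · e_{h-1}[e_2] -
e_h[e_2].

Littlewood's expansion (`plethysmHom_elem`) writes e_h[e_2] as the sum of s_ν over threshold ν ⊢ 2h.
It is proved in finitely many variables: e_h[e_2] is the coefficient of t^h in ∏_{i<j} (1 + t x_i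
x_j). A deformed type D denominator identity turns this product, times the Vandermonde alternant,
into a signed sum of alternants with exponents N ± y. In the bead picture such exponent sets belong
exactly to the threshold partitions, and the signs cancel. The bialternant formula turns alternants
into Schur functions, and the independence of p_1, …, p_n lifts the identity from alphabets to Λ.

By the Pieri rule (`elem_mul_schur`), the coefficient of s_μ in e_2 · e_{h-1}[e_2] is the number of
threshold λ for which μ/λ is a vertical strip of size 2. A removed cell below the diagonal accounts
for an excess of 1 in the length of its column over the threshold value; a removed cell on or right
of the diagonal accounts for an excess of 1 in the length of its row
(`RemovesRows.isThreshold_iff`). If μ is not threshold, its defects determine the two cells, so the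
count is 1 or 0, and it is 1 exactly for the near-threshold shapes. If μ is threshold, the two
changes must cancel, so the cells are the ends of row i and column i for one diagonal index i;
counting such i through corners gives 1 + ⌊(b_μ - 1)/2⌋ (`IsThreshold.floor_numCorners`).
Subtracting e_h[e_2] removes the 1.

The second identity follows by applying ω, which exchanges f[e_2] and f[h_2] because e_2 has even
degree. Everything is done over ℚ and then mapped to K. -/

namespace SymFun

open MvPolynomial Finset

/-! ### Newton's recursion and generating functions -/

theorem complete_zero (K : Type*) [CommRing K] [Algebra ℚ K] : complete K 0 = 1 := by
  rw [complete]

theorem succ_mul_complete (K : Type*) [CommRing K] [Algebra ℚ K] (n : ℕ) :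
    ((n : SymFun K) + 1) * complete K (n + 1) =
      ∑ i ∈ range (n + 1), X (Nat.succPNat i) * complete K (n - i) := by
  rw [complete, mul_smul_comm, ← smul_mul_assoc, Fin.sum_univ_eq_sum_range
    (fun i => (X (Nat.succPNat i) : SymFun K) * complete K (n - i))]
  have h : ((n : ℚ) + 1)⁻¹ • ((n : SymFun K) + 1) = 1 := by
    have : ((n : SymFun K) + 1) = algebraMap ℚ (SymFun K) ((n : ℚ) + 1) := by simp
    rw [this, Algebra.smul_def, ← map_mul, inv_mul_cancel₀ (by positivity), map_one]
  rw [h, one_mul]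

section Recursion

variable {R : Type*} [CommRing R]

theorem natCast_succ_mul_cancel [Algebra ℚ R] (n : ℕ) {a b : R}
    (h : ((n : R) + 1) * a = ((n : R) + 1) * b) : a = b := by
  have hu : algebraMap ℚ R ((n : ℚ) + 1)⁻¹ * ((n : R) + 1) = 1 := by
    have : ((n : R) + 1) = algebraMap ℚ R ((n : ℚ) + 1) := by simp
    rw [this, ← map_mul, inv_mul_cancel₀ (by positivity), map_one]
  calc a = (algebraMap ℚ R ((n : ℚ) + 1)⁻¹ * ((n : R) + 1)) * a := by rw [hu, one_mul]
    _ = (algebraMap ℚ R ((n : ℚ) + 1)⁻¹ * ((n : R) + 1)) * b := by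
        rw [mul_assoc, h, mul_assoc]
    _ = b := by rw [hu, one_mul]

/-- The images of the complete homogeneous symmetric functions under a ring homomorphism are
determined by the Newton recursion. -/
theorem map_complete_eq [Algebra ℚ R] (φ : SymFun ℚ →+* R) (f : ℕ → R) (h0 : f 0 = 1)
    (hs : ∀ n : ℕ, ((n : R) + 1) * f (n + 1) =
      ∑ i ∈ range (n + 1), φ (X (Nat.succPNat i)) * f (n - i)) (n : ℕ) :
    φ (complete ℚ n) = f n := by
  induction n using Nat.strong_induction_on with
  | _ n ih =>
    cases n with
    | zero => rw [complete_zero, map_one, h0]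
    | succ n =>
      apply natCast_succ_mul_cancel n
      rw [hs]
      have := congrArg φ (succ_mul_complete ℚ n)
      simp only [map_mul, map_add, map_natCast, map_one, map_sum] at this
      rw [this]
      refine sum_congr rfl fun i _ => ?_
      rw [ih (n - i) (by omega)]

/-- The generating function of the complete homogeneous symmetric functions. -/
noncomputable def completeSeries (φ : SymFun ℚ →+* R) : PowerSeries R :=
  PowerSeries.mk fun n => φ (complete ℚ n)

/-- The generating function of the power sums, divided by the variable. -/
noncomputable def psumSeries (φ : SymFun ℚ →+* R) : PowerSeries R :=
  PowerSeries.mk fun n => φ (X (Nat.succPNat n))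

/-- Newton's recursion is the differential equation H' = P H, where P is the series of power sums;
over ℚ it has one solution with constant term 1. -/
theorem eq_completeSeries [Algebra ℚ R] (φ : SymFun ℚ →+* R) (F : PowerSeries R)
    (h0 : PowerSeries.constantCoeff F = 1)
    (hF : PowerSeries.derivative R F = psumSeries φ * F) : completeSeries φ = F := by
  ext n
  rw [completeSeries, PowerSeries.coeff_mk]
  refine map_complete_eq φ (fun n => PowerSeries.coeff n F) (by simpa using h0) (fun n => ?_) n
  have := congrArg (PowerSeries.coeff n) hF
  rw [PowerSeries.coeff_derivative, PowerSeries.coeff_mul,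
    Finset.Nat.sum_antidiagonal_eq_sum_range_succ
      (fun i j => PowerSeries.coeff i (psumSeries φ) * PowerSeries.coeff j F)] at this
  rw [mul_comm, this]
  simp [psumSeries]

theorem constantCoeff_completeSeries (φ : SymFun ℚ →+* R) :
    PowerSeries.constantCoeff (completeSeries φ) = 1 := by
  rw [← PowerSeries.coeff_zero_eq_constantCoeff_apply, completeSeries, PowerSeries.coeff_mk,
    complete_zero, map_one]

theorem derivative_completeSeries (φ : SymFun ℚ →+* R) :
    PowerSeries.derivative R (completeSeries φ) = psumSeries φ * completeSeries φ := by
  ext n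
  rw [PowerSeries.coeff_derivative, PowerSeries.coeff_mul,
    Finset.Nat.sum_antidiagonal_eq_sum_range_succ
      (fun i j => PowerSeries.coeff i (psumSeries φ) * PowerSeries.coeff j (completeSeries φ))]
  have := congrArg φ (succ_mul_complete ℚ n)
  simp only [map_mul, map_add, map_natCast, map_one, map_sum] at this
  simp only [completeSeries, psumSeries, PowerSeries.coeff_mk]
  rw [mul_comm, this]

theorem eq_one_of_derivative_eq_zero [Algebra ℚ R] {F : PowerSeries R}
    (h0 : PowerSeries.constantCoeff F = 1) (hF : PowerSeries.derivative R F = 0) : F = 1 := by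
  ext n
  cases n with
  | zero => simpa using h0
  | succ n =>
    have := congrArg (PowerSeries.coeff n) hF
    rw [PowerSeries.coeff_derivative, map_zero, mul_comm] at this
    rw [natCast_succ_mul_cancel n (this.trans (mul_zero _).symm), PowerSeries.coeff_one,
      if_neg n.succ_ne_zero]

theorem completeSeries_mul_eq_one [Algebra ℚ R] (φ : SymFun ℚ →+* R) (G : PowerSeries R)
    (h0 : PowerSeries.constantCoeff G = 1)
    (hG : PowerSeries.derivative R G = -(psumSeries φ * G)) : completeSeries φ * G = 1 := by
  refine eq_one_of_derivative_eq_zero ?_ ?_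
  · rw [map_mul, constantCoeff_completeSeries, h0, one_mul]
  · rw [Derivation.leibniz, derivative_completeSeries, hG, smul_eq_mul, smul_eq_mul]
    ring

theorem constantCoeff_prod_one_sub {ι : Type*} (s : Finset ι) (y : ι → R) :
    PowerSeries.constantCoeff (∏ i ∈ s, (1 - PowerSeries.C (y i) * PowerSeries.X)) = 1 := by
  rw [map_prod]
  exact prod_eq_one fun i _ => by simp

/-- The logarithmic derivative of 1 - yX is -y/(1 - yX) = -∑ y^{n+1} X^n. The equation `key` clears
this denominator, and the product is treated by the Leibniz rule. -/
theorem derivative_prod_one_sub {ι : Type*} (s : Finset ι) (y : ι → R) :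
    PowerSeries.derivative R (∏ i ∈ s, (1 - PowerSeries.C (y i) * PowerSeries.X)) =
      -(PowerSeries.mk (fun n => ∑ i ∈ s, y i ^ (n + 1)) *
        ∏ i ∈ s, (1 - PowerSeries.C (y i) * PowerSeries.X)) := by
  classical
  induction s using Finset.induction_on with
  | empty => simp [show (PowerSeries.mk fun _ : ℕ => (0 : R)) = 0 from by ext; simp]
  | insert a s ha ih =>
    have key : (PowerSeries.mk fun n => y a ^ (n + 1)) *
        (1 - PowerSeries.C (y a) * PowerSeries.X) = PowerSeries.C (y a) := by
      ext n
      cases n with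
      | zero => simp [mul_sub]
      | succ n =>
        rw [mul_sub, mul_one, map_sub, PowerSeries.coeff_mk, mul_comm, mul_assoc,
          PowerSeries.coeff_C_mul, mul_comm PowerSeries.X, PowerSeries.coeff_succ_mul_X,
          PowerSeries.coeff_mk, PowerSeries.coeff_C, if_neg n.succ_ne_zero]
        ring
    have hsum : (PowerSeries.mk fun n => ∑ i ∈ insert a s, y i ^ (n + 1)) =
        (PowerSeries.mk fun n => y a ^ (n + 1)) +
          PowerSeries.mk fun n => ∑ i ∈ s, y i ^ (n + 1) := by
      ext n
      simp [sum_insert ha]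
    rw [prod_insert ha, Derivation.leibniz, ih, hsum]
    simp only [smul_eq_mul, map_sub, Derivation.leibniz, PowerSeries.derivative_C,
      PowerSeries.derivative_X, mul_zero, add_zero, mul_one, PowerSeries.derivative_one]
    linear_combination (∏ i ∈ s, (1 - PowerSeries.C (y i) * PowerSeries.X)) * key

theorem completeSeries_mul_prod [Algebra ℚ R] {ι : Type*} [Fintype ι] (φ : SymFun ℚ →+* R) (y : ι → R)
    (hφ : ∀ n : ℕ, φ (X (Nat.succPNat n)) = ∑ i, y i ^ (n + 1)) :
    completeSeries φ * ∏ i, (1 - PowerSeries.C (y i) * PowerSeries.X) = 1 := by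
  refine completeSeries_mul_eq_one φ _ (constantCoeff_prod_one_sub _ _) ?_
  rw [derivative_prod_one_sub, psumSeries]
  simp only [hφ]

theorem completeSeries_eq_prod [Algebra ℚ R] {ι : Type*} [Fintype ι] (φ : SymFun ℚ →+* R) (y : ι → R)
    (hφ : ∀ n : ℕ, φ (X (Nat.succPNat n)) = (-1) ^ n * ∑ i, y i ^ (n + 1)) :
    completeSeries φ = ∏ i, (1 + PowerSeries.C (y i) * PowerSeries.X) := by
  have h : ∏ i, (1 + PowerSeries.C (y i) * PowerSeries.X) =
      ∏ i, (1 - PowerSeries.C (- y i) * PowerSeries.X) :=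
    prod_congr rfl fun i _ => by simp
  rw [h]
  refine eq_completeSeries φ _ (constantCoeff_prod_one_sub _ _) ?_
  rw [derivative_prod_one_sub, psumSeries, ← neg_mul]
  congr 1
  ext n
  simp only [hφ, map_neg, PowerSeries.coeff_mk, mul_sum, ← sum_neg_distrib]
  refine sum_congr rfl fun i _ => ?_
  rw [neg_pow (y i), pow_succ]
  ring

end Recursion

/-! ### The involution ω and elementary symmetric functions -/

/-- The involution `ω` of the ring of symmetric functions, `p_r ↦ (-1)^{r-1} p_r`. -/
noncomputable def omega : SymFun ℚ →ₐ[ℚ] SymFun ℚ :=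
  aeval fun r => (-1) ^ ((r : ℕ) + 1) * X r

/-- The elementary symmetric functions. -/
noncomputable def elem (n : ℕ) : SymFun ℚ := omega (complete ℚ n)

theorem omega_X (n : ℕ) : omega (X (Nat.succPNat n)) = (-1) ^ n * X (Nat.succPNat n) := by
  rw [omega, aeval_X, Nat.succPNat_coe, Nat.succ_eq_add_one, add_assoc, pow_add]
  simp

theorem omega_omega (f : SymFun ℚ) : omega (omega f) = f := by
  have : omega.comp omega = AlgHom.id ℚ _ := by
    ext r : 1
    obtain ⟨n, rfl⟩ : ∃ n, r = Nat.succPNat n := ⟨r.natPred, by simp⟩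
    simp only [AlgHom.comp_apply, omega_X, map_mul, map_pow, map_neg, map_one, AlgHom.id_apply]
    rw [← mul_assoc, ← mul_pow]
    simp
  exact DFunLike.congr_fun this f

theorem elem_zero : elem 0 = 1 := by rw [elem, complete_zero, map_one]

theorem complete_one : complete ℚ 1 = X 1 := by
  have := succ_mul_complete ℚ 0
  simpa [complete_zero, show Nat.succPNat 0 = 1 from rfl] using this

theorem elem_one : elem 1 = X 1 := by
  rw [elem, complete_one]
  simpa [show Nat.succPNat 0 = 1 from rfl] using omega_X 0

theorem omega_elem (n : ℕ) : omega (elem n) = complete ℚ n := omega_omega _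

theorem succ_mul_elem (n : ℕ) : ((n : SymFun ℚ) + 1) * elem (n + 1) =
    ∑ i ∈ range (n + 1), (-1) ^ i * X (Nat.succPNat i) * elem (n - i) := by
  have := congrArg omega (succ_mul_complete ℚ n)
  simp only [map_mul, map_add, map_natCast, map_one, map_sum, omega_X] at this
  exact this

/-- This is H(t) E(-t) = 1: the series E(-t) solves G' = -P G by Newton's recursion for e_n. -/
theorem sum_neg_one_pow_elem_mul_complete (n : ℕ) :
    ∑ p ∈ antidiagonal n, complete ℚ p.1 * ((-1) ^ p.2 * elem p.2) = if n = 0 then 1 else 0 := by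
  have h := completeSeries_mul_eq_one (RingHom.id (SymFun ℚ))
    (PowerSeries.mk fun n => (-1) ^ n * elem n) (by simp [elem_zero]) (by
      ext n : 1
      rw [PowerSeries.coeff_derivative, map_neg, PowerSeries.coeff_mul,
        Finset.Nat.sum_antidiagonal_eq_sum_range_succ
          (fun i j => PowerSeries.coeff i (psumSeries (RingHom.id (SymFun ℚ))) * PowerSeries.coeff j
            (PowerSeries.mk fun n => (-1) ^ n * elem n))]
      simp only [psumSeries, PowerSeries.coeff_mk, RingHom.id_apply]
      rw [mul_comm, mul_left_comm, succ_mul_elem, mul_sum, ← sum_neg_distrib]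
      refine sum_congr rfl fun i hi => ?_
      have hi' : n + 1 = (n - i) + i + 1 := by have := mem_range.1 hi; omega
      rw [hi', pow_succ, pow_add]
      have : ((-1 : SymFun ℚ)) ^ i * (-1) ^ i = 1 := by rw [← mul_pow]; simp
      linear_combination (-(-1) ^ (n - i) * X (Nat.succPNat i) * elem (n - i)) * this)
  have := congrArg (PowerSeries.coeff n) h
  rw [PowerSeries.coeff_mul, PowerSeries.coeff_one] at this
  simpa [completeSeries] using this

end SymFun

/-! ### Signs of permutations through inversions -/

open Finset in
theorem Equiv.Perm.sign_eq_neg_one_pow_card_inversions_fin {n : ℕ} (σ : Equiv.Perm (Fin n)) :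
    (σ.sign : ℤ) = (-1) ^ (univ.filter fun x : Fin n × Fin n => x.1 < x.2 ∧ σ x.2 < σ x.1).card := by
  rw [sign_eq_prod_prod_Ioi, ← prod_const, prod_filter, ← univ_product_univ, prod_product]
  push_cast
  refine prod_congr rfl fun i _ => ?_
  rw [← filter_lt_eq_Ioi, prod_filter]
  refine prod_congr rfl fun j _ => ?_
  by_cases hij : i < j
  · have hne : σ i ≠ σ j := fun h => hij.ne (σ.injective h)
    rcases lt_or_gt_of_ne hne with h | h
    · simp [hij, h, h.not_gt]
    · simp [hij, h, h.not_gt]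
  · simp [hij]

open Finset in
/-- The sign of a permutation counts inversions, with respect to any injective labelling. -/
theorem Equiv.Perm.sign_eq_neg_one_pow_card_inversions {ι : Type*} [Fintype ι] [DecidableEq ι]
    (σ : Equiv.Perm ι) (p : ι → ℤ) (hp : Function.Injective p) :
    (σ.sign : ℤ) =
      (-1) ^ (univ.filter fun x : ι × ι => p x.1 < p x.2 ∧ p (σ x.2) < p (σ x.1)).card := by
  let _ : LinearOrder ι := LinearOrder.lift' p hp
  have hlt : ∀ a b : ι, p a < p b ↔ a < b := fun a b => Iff.rfl
  let e : Fin (Fintype.card ι) ≃o ι := Fintype.orderIsoFinOfCardEq ι rfl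
  have h1 : σ.sign = (e.toEquiv.symm.permCongr σ).sign := by
    rw [Equiv.Perm.sign_permCongr]
  rw [h1, sign_eq_neg_one_pow_card_inversions_fin]
  congr 1
  refine card_equiv (Equiv.prodCongr e.toEquiv e.toEquiv) fun x => ?_
  simp [hlt]

/-! ### Beads and holes of a partition -/

namespace YoungDiagram

open Finset

/-- The position of the bead of row `i`. -/
def bead (μ : YoungDiagram) (i : ℕ) : ℤ := μ.rowLen i - i

/-- The position of the hole of column `j`. -/
def hole (μ : YoungDiagram) (j : ℕ) : ℤ := j + 1 - μ.colLen j

theorem bead_strictAnti (μ : YoungDiagram) : StrictAnti μ.bead := fun i j hij => by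
  have := μ.rowLen_anti i j hij.le
  simp only [bead]
  omega

theorem hole_strictMono (μ : YoungDiagram) : StrictMono μ.hole := fun i j hij => by
  have := μ.colLen_anti i j hij.le
  simp only [hole]
  omega

theorem lt_rowLen_iff_lt_colLen {μ : YoungDiagram} {i j : ℕ} :
    j < μ.rowLen i ↔ i < μ.colLen j := by
  rw [← mem_iff_lt_rowLen, mem_iff_lt_colLen]

/-- Cells are thus the pairs of a bead and a hole to its left. This is what turns inversion counts
into sizes of partitions. -/
theorem hole_lt_bead_iff {μ : YoungDiagram} {i j : ℕ} : μ.hole j < μ.bead i ↔ (i, j) ∈ μ := by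
  rw [mem_iff_lt_rowLen]
  have := lt_rowLen_iff_lt_colLen (μ := μ) (i := i) (j := j)
  simp only [hole, bead]
  omega

theorem bead_ne_hole (μ : YoungDiagram) (i j : ℕ) : μ.bead i ≠ μ.hole j := by
  have := lt_rowLen_iff_lt_colLen (μ := μ) (i := i) (j := j)
  simp only [hole, bead]
  omega

theorem exists_bead_or_exists_hole (μ : YoungDiagram) (m : ℤ) :
    (∃ i, μ.bead i = m) ∨ ∃ j, μ.hole j = m := by
  classical
  have hex : ∃ i, μ.bead i ≤ m := by
    refine ⟨(μ.rowLen 0 - m).toNat, ?_⟩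
    have := μ.rowLen_anti 0 (μ.rowLen 0 - m).toNat (Nat.zero_le _)
    simp only [bead]
    omega
  have hi := Nat.find_spec hex
  have hmin : ∀ k < Nat.find hex, ¬ μ.bead k ≤ m := fun k hk => Nat.find_min hex hk
  generalize Nat.find hex = i at hi hmin
  by_cases h : μ.bead i = m
  · exact Or.inl ⟨i, h⟩
  · right
    simp only [bead] at h hi hmin
    -- Here `i` is the first row with bead at most `m`. A column with hole `m` must have length `i`,
    -- which fixes its index as `m - 1 + i`.
    refine ⟨(m - 1 + i).toNat, ?_⟩
    have h1 := lt_rowLen_iff_lt_colLen (μ := μ) (i := i) (j := (m - 1 + i).toNat)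
    have h2 := lt_rowLen_iff_lt_colLen (μ := μ) (i := i - 1) (j := (m - 1 + i).toNat)
    simp only [hole]
    rcases Nat.eq_zero_or_pos i with rfl | hpos
    · omega
    · have := hmin (i - 1) (by omega)
      omega

theorem card_eq_sum_rowLen (μ : YoungDiagram) {n : ℕ} (hn : μ.colLen 0 ≤ n) :
    μ.card = ∑ i ∈ range n, μ.rowLen i := by
  have h : ∀ c ∈ μ.cells, c.1 ∈ range n := by
    rintro ⟨i, j⟩ hc
    have := mem_iff_lt_colLen.1 (μ.up_left_mem le_rfl (Nat.zero_le j) hc)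
    exact mem_range.2 (this.trans_le hn)
  rw [YoungDiagram.card, card_eq_sum_card_fiberwise h]
  exact sum_congr rfl fun i _ => (rowLen_eq_card μ).symm

theorem card_transpose (μ : YoungDiagram) : μ.transpose.card = μ.card := by
  simp [YoungDiagram.card, transpose]

theorem card_eq_sum_colLen (μ : YoungDiagram) {n : ℕ} (hn : μ.rowLen 0 ≤ n) :
    μ.card = ∑ i ∈ range n, μ.colLen i := by
  rw [← card_transpose, card_eq_sum_rowLen μ.transpose (n := n) (by simpa using hn)]
  simp

theorem rowLen_eq_zero {μ : YoungDiagram} {i : ℕ} (h : μ.colLen 0 ≤ i) : μ.rowLen i = 0 := by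
  have := lt_rowLen_iff_lt_colLen (μ := μ) (i := i) (j := 0)
  omega

theorem colLen_le {μ : YoungDiagram} (i : ℕ) : μ.colLen i ≤ μ.colLen 0 :=
  μ.colLen_anti 0 i (Nat.zero_le i)

theorem rowLen_le {μ : YoungDiagram} (i : ℕ) : μ.rowLen i ≤ μ.rowLen 0 :=
  μ.rowLen_anti 0 i (Nat.zero_le i)

theorem ext_rowLen {μ ν : YoungDiagram} (h : ∀ i, μ.rowLen i = ν.rowLen i) : μ = ν := by
  ext ⟨i, j⟩
  rw [mem_cells, mem_cells, mem_iff_lt_rowLen, mem_iff_lt_rowLen, h]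

end YoungDiagram

/-! ### Complementary minors and the dual Jacobi–Trudi formula -/

namespace Matrix

variable {m n R : Type*} [Fintype m] [Fintype n] [DecidableEq m] [DecidableEq n] [CommRing R]

/-- Jacobi's identity for complementary minors, for diagonal blocks. -/
theorem det_toBlocks₁₁_eq_det_mul_det_toBlocks₂₂ {A B : Matrix (m ⊕ n) (m ⊕ n) R}
    (h : A * B = 1) : A.toBlocks₁₁.det = A.det * B.toBlocks₂₂.det := by
  rw [← fromBlocks_toBlocks A, ← fromBlocks_toBlocks B, fromBlocks_multiply,
    ← fromBlocks_one] at h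
  obtain ⟨-, h12, -, h22⟩ := fromBlocks_inj.1 h
  -- Replacing the first block column of `B` by that of the identity keeps the second block column
  -- of `A * B`, so both the new factor and the product are block triangular.
  have key : A * fromBlocks 1 B.toBlocks₁₂ 0 B.toBlocks₂₂ =
      fromBlocks A.toBlocks₁₁ 0 A.toBlocks₂₁ 1 := by
    conv_lhs => rw [← fromBlocks_toBlocks A, fromBlocks_multiply]
    rw [h12, h22]
    simp
  have := congrArg det key
  rw [det_mul, det_fromBlocks_zero₂₁, det_fromBlocks_zero₁₂, det_one, det_one, one_mul,
    mul_one] at this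
  exact this.symm

end Matrix

namespace SymFun

open Finset Matrix

/-- The lower triangular Toeplitz matrix of the complete homogeneous symmetric functions. -/
noncomputable def completeMatrix (N : ℕ) : Matrix (Fin N) (Fin N) (SymFun ℚ) :=
  of fun a b => if (b : ℕ) ≤ a then complete ℚ (a - b) else 0

/-- The inverse of the Toeplitz matrix of the complete homogeneous symmetric functions. -/
noncomputable def elemMatrix (N : ℕ) : Matrix (Fin N) (Fin N) (SymFun ℚ) :=
  of fun a b => if (b : ℕ) ≤ a then (-1) ^ ((a : ℕ) - b) * elem (a - b) else 0

theorem det_completeMatrix (N : ℕ) : (completeMatrix N).det = 1 := by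
  rw [det_of_isLowerTriangular]
  · exact prod_eq_one fun i _ => by simp [completeMatrix, complete_zero]
  · intro a b hab
    have : ¬ (b : ℕ) ≤ a := not_le.2 hab
    exact if_neg this

/-- Lower triangular Toeplitz matrices multiply like power series, so this is H(t) E(-t) = 1. -/
theorem completeMatrix_mul_elemMatrix (N : ℕ) : completeMatrix N * elemMatrix N = 1 := by
  ext1 a b
  rw [mul_apply, one_apply]
  simp only [completeMatrix, elemMatrix, of_apply]
  rw [Fin.sum_univ_eq_sum_range (fun c => (if c ≤ (a : ℕ) then complete ℚ (a - c) else 0) *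
    (if (b : ℕ) ≤ c then (-1) ^ (c - (b : ℕ)) * elem (c - b) else 0)) N]
  have hsub : Finset.Ico (b : ℕ) (a + 1) ⊆ range N := fun c hc => by
    have := mem_Ico.1 hc
    have := a.2
    exact mem_range.2 (by omega)
  rw [← sum_subset hsub]
  · rw [sum_Ico_eq_sum_range]
    by_cases hba : (b : ℕ) ≤ a
    · have h := sum_neg_one_pow_elem_mul_complete ((a : ℕ) - b)
      rw [Finset.Nat.sum_antidiagonal_eq_sum_range_succ
        (fun i j => complete ℚ i * ((-1) ^ j * elem j)), ← sum_range_reflect] at h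
      rw [show ((a : ℕ) + 1 - b) = ((a : ℕ) - b).succ by omega]
      trans (if (a : ℕ) - b = 0 then 1 else 0 : SymFun ℚ)
      · rw [← h]
        refine sum_congr rfl fun k hk => ?_
        have := mem_range.1 hk
        rw [if_pos (by omega), if_pos (by omega), show (a : ℕ) - (b + k) =
          ((a : ℕ) - b).succ - 1 - k by omega, show (b : ℕ) + k - b =
          (a : ℕ) - b - (((a : ℕ) - b).succ - 1 - k) by omega]
      · have : (a : ℕ) - b = 0 ↔ a = b := by rw [Fin.ext_iff]; omega
        simp only [this]
    · rw [show (a : ℕ) + 1 - b = 0 by omega, if_neg (fun h => hba (by rw [h]))]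
      simp
  · intro c _ hc
    rw [mem_Ico] at hc
    by_cases h1 : c ≤ (a : ℕ)
    · rw [if_neg (show ¬ (b : ℕ) ≤ c by omega), mul_zero]
    · rw [if_neg h1, zero_mul]

end SymFun

namespace YoungDiagram

open Finset

section Box

variable (μ : YoungDiagram) (l m : ℕ)

/-- The position, counted from `0`, of a bead or a hole of a partition in an `l × m` box. -/
def boxPos (x : Fin l ⊕ Fin m) : ℤ :=
  Sum.elim (fun i : Fin l => μ.bead i) (fun j : Fin m => μ.hole j) x + l - 1

theorem boxPos_injective : Function.Injective (μ.boxPos l m) := by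
  rintro (i | i) (j | j) h <;> simp only [boxPos, Sum.elim_inl, Sum.elim_inr] at h
  · exact congrArg _ (Fin.ext (μ.bead_strictAnti.injective (by omega)))
  · exact absurd (by omega) (μ.bead_ne_hole i j)
  · exact absurd (by omega) (μ.bead_ne_hole j i)
  · exact congrArg _ (Fin.ext (μ.hole_strictMono.injective (by omega)))

variable {l m}

theorem boxPos_mem (hl : μ.colLen 0 ≤ l) (hm : μ.rowLen 0 ≤ m) (x : Fin l ⊕ Fin m) : 0 ≤ μ.boxPos l m x ∧ μ.boxPos l m x < l + m := by
  rcases x with i | i <;> simp only [boxPos, Sum.elim_inl, Sum.elim_inr, bead, hole]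
  · have := μ.rowLen_le i
    omega
  · have := μ.colLen_le i
    omega

variable (hl : μ.colLen 0 ≤ l) (hm : μ.rowLen 0 ≤ m)

/-- The beads and holes of a partition in an `l × m` box fill the positions from `0` to
`l + m - 1`. -/
noncomputable def boxEquiv : Fin l ⊕ Fin m ≃ Fin (l + m) :=
  Equiv.ofBijective
    (fun x => ⟨(μ.boxPos l m x).toNat, by have := μ.boxPos_mem hl hm x; omega⟩) (by
      rw [Fintype.bijective_iff_injective_and_card]
      refine ⟨fun x y h => μ.boxPos_injective l m ?_, by simp⟩
      have h' := congrArg Fin.val h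
      have := μ.boxPos_mem hl hm x
      have := μ.boxPos_mem hl hm y
      simp only at h'
      omega)

theorem boxEquiv_apply (x : Fin l ⊕ Fin m) :
    ((μ.boxEquiv hl hm x : ℕ) : ℤ) = μ.boxPos l m x := by
  have := μ.boxPos_mem hl hm x
  simp only [boxEquiv, Equiv.ofBijective_apply]
  omega

theorem rowLen_bot (i : ℕ) : (⊥ : YoungDiagram).rowLen i = 0 := by
  by_contra h
  exact notMem_bot _ (mem_iff_lt_rowLen.2 (Nat.pos_of_ne_zero h))

theorem colLen_bot (i : ℕ) : (⊥ : YoungDiagram).colLen i = 0 := by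
  by_contra h
  exact notMem_bot _ (mem_iff_lt_colLen.2 (Nat.pos_of_ne_zero h))

theorem boxPos_bot_inl (i : Fin l) : (⊥ : YoungDiagram).boxPos l m (Sum.inl i) = l - 1 - i := by
  simp only [boxPos, Sum.elim_inl, bead, rowLen_bot]
  omega

theorem boxPos_bot_inr (i : Fin m) : (⊥ : YoungDiagram).boxPos l m (Sum.inr i) = l + i := by
  simp only [boxPos, Sum.elim_inr, hole, colLen_bot]
  omega

/-- In the order of the empty partition all beads precede all holes, and each family stays monotone
for μ. Hence the inversions are the pairs of a bead with a smaller hole, which are the cells of μ.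
-/
theorem sign_boxEquiv :
    (Equiv.Perm.sign ((μ.boxEquiv hl hm).trans
      ((⊥ : YoungDiagram).boxEquiv (l := l) (m := m) (by simp [colLen_bot])
        (by simp [rowLen_bot])).symm) : ℤ) = (-1) ^ μ.card := by
  rw [Equiv.Perm.sign_eq_neg_one_pow_card_inversions _ ((⊥ : YoungDiagram).boxPos l m)
    (boxPos_injective _ _ _)]
  congr 1
  simp only [← boxEquiv_apply ⊥ (l := l) (m := m) (by simp [colLen_bot]) (by simp [rowLen_bot])]
  simp only [Equiv.trans_apply, Equiv.apply_symm_apply, boxEquiv_apply]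
  symm
  refine card_bij' (i := fun c hc => (Sum.inl ⟨c.1, ?_⟩, Sum.inr ⟨c.2, ?_⟩))
    (j := fun x _ => (Sum.elim (fun i : Fin l => (i : ℕ)) (fun _ => 0) x.1,
      Sum.elim (fun _ => 0) (fun j : Fin m => (j : ℕ)) x.2)) ?_ ?_ ?_ ?_
  · have h1 := mem_iff_lt_colLen.1 ((mem_cells _).1 hc)
    have := μ.colLen_le c.2
    omega
  · have h1 := mem_iff_lt_rowLen.1 ((mem_cells _).1 hc)
    have := μ.rowLen_le c.1
    omega
  · rintro ⟨i, j⟩ hc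
    have h := hole_lt_bead_iff.2 ((mem_cells _).1 hc)
    rw [mem_filter, boxPos_bot_inl, boxPos_bot_inr]
    simp only [boxPos, Sum.elim_inl, Sum.elim_inr, mem_univ, true_and]
    omega
  · rintro ⟨i | i, j | j⟩ hx <;> rw [mem_filter] at hx <;>
      simp only [boxPos_bot_inl, boxPos_bot_inr, mem_univ, true_and] at hx <;>
      simp only [boxPos, Sum.elim_inl, Sum.elim_inr] at hx ⊢
    · have := μ.bead_strictAnti.lt_iff_gt (a := i) (b := j)
      omega
    · exact (mem_cells _).2 (hole_lt_bead_iff.1 (by omega))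
    · omega
    · have := μ.hole_strictMono.lt_iff_lt (a := i) (b := j)
      omega
  · rintro ⟨i, j⟩ hc
    rfl
  · rintro ⟨i | i, j | j⟩ hx <;> rw [mem_filter] at hx <;>
      simp only [boxPos_bot_inl, boxPos_bot_inr, mem_univ, true_and] at hx <;>
      simp only [boxPos, Sum.elim_inl, Sum.elim_inr] at hx ⊢
    · have := μ.bead_strictAnti.lt_iff_gt (a := i) (b := j)
      omega
    · omega
    · have := μ.hole_strictMono.lt_iff_lt (a := i) (b := j)
      omega

end Box

end YoungDiagram

namespace SymFun

open Finset Matrix YoungDiagram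

theorem card_eq_sum_fin_colLen (μ : YoungDiagram) {m : ℕ} (hm : μ.rowLen 0 ≤ m) :
    μ.card = ∑ j : Fin m, μ.colLen j := by
  rw [μ.card_eq_sum_colLen hm, ← Fin.sum_univ_eq_sum_range]

/-- The Jacobi–Trudi determinant and its dual agree, for a partition in an `l × m` box. -/
theorem det_complete_eq_det_elem (μ : YoungDiagram) {l m : ℕ} (hl : μ.colLen 0 ≤ l)
    (hm : μ.rowLen 0 ≤ m) :
    det (of fun i j : Fin l => if (i : ℕ) ≤ μ.rowLen i + j then
        complete ℚ (μ.rowLen i + j - i) else 0) =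
      det (of fun i j : Fin m => if (i : ℕ) ≤ μ.colLen i + j then
        elem (μ.colLen i + j - i) else 0) := by
  set f := μ.boxEquiv hl hm with hf
  set g := (⊥ : YoungDiagram).boxEquiv (l := l) (m := m) (by simp [colLen_bot])
        (by simp [rowLen_bot]) with hg
  have hfl : ∀ i : Fin l, ((f (Sum.inl i) : ℕ) : ℤ) = μ.rowLen i - i + l - 1 := fun i => by
    rw [hf, boxEquiv_apply]; rfl
  have hfr : ∀ j : Fin m, ((f (Sum.inr j) : ℕ) : ℤ) = j + 1 - μ.colLen j + l - 1 := fun i => by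
    rw [hf, boxEquiv_apply]; rfl
  have hgl : ∀ i : Fin l, ((g (Sum.inl i) : ℕ) : ℤ) = l - 1 - i := fun i => by
    rw [hg, boxEquiv_apply, boxPos_bot_inl]
  have hgr : ∀ j : Fin m, ((g (Sum.inr j) : ℕ) : ℤ) = l + j := fun i => by
    rw [hg, boxEquiv_apply, boxPos_bot_inr]
  -- The rows are listed by the beads, then the holes of μ, the columns by those of the empty
  -- partition. The two diagonal blocks then become the determinants to be compared, up to signs.
  have hmul : (completeMatrix (l + m)).submatrix f g * (elemMatrix (l + m)).submatrix g f = 1 := by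
    rw [submatrix_mul_equiv, completeMatrix_mul_elemMatrix, submatrix_one_equiv]
  have hdet : ((completeMatrix (l + m)).submatrix f g).det = (-1) ^ μ.card := by
    have : (completeMatrix (l + m)).submatrix f g =
        ((completeMatrix (l + m)).submatrix g g).submatrix (f.trans g.symm) id := by
      ext1 a b
      simp
    rw [this, det_permute, det_submatrix_equiv_self, det_completeMatrix, mul_one,
      sign_boxEquiv μ hl hm]
    simp
  have h11 : ((completeMatrix (l + m)).submatrix f g).toBlocks₁₁ =
      of fun i j : Fin l => if (i : ℕ) ≤ μ.rowLen i + j then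
        complete ℚ (μ.rowLen i + j - i) else 0 := by
    ext1 i j
    simp only [toBlocks₁₁, submatrix_apply, of_apply, completeMatrix]
    have h1 := hfl i
    have h2 := hgl j
    have hi := i.2
    have hj := j.2
    by_cases h : (i : ℕ) ≤ μ.rowLen i + j
    · rw [if_pos h, if_pos (by omega)]
      congr 1
      omega
    · rw [if_neg h, if_neg (by omega)]
  set E : Matrix (Fin m) (Fin m) (SymFun ℚ) :=
    of fun i j => if (i : ℕ) ≤ μ.colLen i + j then elem (μ.colLen i + j - i) else 0 with hE
  have h22 : ((elemMatrix (l + m)).submatrix g f).toBlocks₂₂ =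
      of fun k j : Fin m => (-1) ^ (k : ℕ) *
        (of fun k j : Fin m => (-1) ^ ((j : ℕ) + μ.colLen j) * Eᵀ k j) k j := by
    ext1 k j
    simp only [toBlocks₂₂, submatrix_apply, of_apply, elemMatrix, transpose_apply, hE]
    have h1 := hfr j
    have h2 := hgr k
    by_cases h : (j : ℕ) ≤ μ.colLen j + k
    · rw [if_pos h, if_pos (by omega), ← mul_assoc, ← pow_add]
      have h3 : (g (Sum.inr k) : ℕ) - (f (Sum.inr j) : ℕ) = μ.colLen j + k - j := by omega
      rw [h3, show (k : ℕ) + (j + μ.colLen j) = (μ.colLen j + k - j) + 2 * j by omega,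
        pow_add _ _ (2 * (j : ℕ)), pow_mul]
      simp
    · rw [if_neg h, if_neg (by omega), mul_zero, mul_zero]
  have hJ := det_toBlocks₁₁_eq_det_mul_det_toBlocks₂₂ hmul
  rw [h11, hdet, h22, det_mul_column, det_mul_row, det_transpose] at hJ
  -- The size of μ is the sum of its column lengths, so the three signs combine to an even power of
  -- -1 in each column.
  rw [hJ, ← mul_assoc, ← mul_assoc, card_eq_sum_fin_colLen μ hm, ← prod_pow_eq_pow_sum,
    ← prod_mul_distrib, ← prod_mul_distrib, prod_eq_one, one_mul]
  intro j _
  rw [← pow_add, ← pow_add, show μ.colLen j + (j : ℕ) + (j + μ.colLen j) =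
    2 * (j + μ.colLen j) by ring, pow_mul]
  simp

/-- The Jacobi–Trudi determinant may be padded by empty rows. -/
theorem schur_eq_det (μ : YoungDiagram) {n : ℕ} (hn : μ.colLen 0 ≤ n) :
    schur ℚ μ = det (of fun i j : Fin n => if (i : ℕ) ≤ μ.rowLen i + j then
        complete ℚ (μ.rowLen i + j - i) else 0) := by
  rw [schur, det_complete_eq_det_elem μ le_rfl le_rfl, det_complete_eq_det_elem μ hn le_rfl]

/-- ω carries the determinant in the h's to the one in the e's, which is the dual formula for the
transpose. -/
theorem omega_schur (μ : YoungDiagram) : omega (schur ℚ μ) = schur ℚ μ.transpose := by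
  have h := schur_eq_det μ.transpose (n := μ.transpose.colLen 0) le_rfl
  rw [det_complete_eq_det_elem μ.transpose le_rfl (m := μ.colLen 0) (by simp)] at h
  rw [h, schur, AlgHom.map_det]
  congr 1
  ext1 i j
  simp only [AlgHom.mapMatrix_apply, Matrix.map_apply, of_apply, colLen_transpose]
  split_ifs
  · rfl
  · simp

theorem rowLen_twoOnes_zero (k : ℕ) : (twoOnes k).rowLen 0 = 2 :=
  rowLen_ofRowLens (w := 2 :: List.replicate k 1) ⟨0, by simp⟩

theorem mem_twoOnes {k : ℕ} {c : ℕ × ℕ} :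
    c ∈ twoOnes k ↔ c = (0, 1) ∨ c.2 = 0 ∧ c.1 < k + 1 := by
  obtain ⟨i, j⟩ := c
  rw [twoOnes, mem_ofRowLens]
  cases i with
  | zero => simp; omega
  | succ i => simp; omega

/-- There are two columns, of lengths k + 1 and 1, so the dual formula is a 2 × 2 determinant. -/
theorem schur_twoOnes (k : ℕ) :
    schur ℚ (twoOnes k) = elem (k + 1) * elem 1 - elem (k + 2) := by
  have h0 : (twoOnes k).colLen 0 = k + 1 := by
    have h1 := mem_iff_lt_colLen.symm.trans (mem_twoOnes (k := k) (c := (k + 1, 0)))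
    have h2 := mem_iff_lt_colLen.symm.trans (mem_twoOnes (k := k) (c := (k, 0)))
    simp at h1 h2
    omega
  have h1 : (twoOnes k).colLen 1 = 1 := by
    have h1 := mem_iff_lt_colLen.symm.trans (mem_twoOnes (k := k) (c := (1, 1)))
    have h2 := mem_iff_lt_colLen.symm.trans (mem_twoOnes (k := k) (c := (0, 1)))
    simp at h1 h2
    omega
  rw [schur, det_complete_eq_det_elem (twoOnes k) le_rfl (rowLen_twoOnes_zero k).le,
    det_fin_two]
  simp [h0, h1, elem_zero]

theorem schur_colTwo : schur ℚ colTwo = elem 2 := by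
  have hmem : ∀ c : ℕ × ℕ, c ∈ colTwo ↔ c.2 = 0 ∧ c.1 < 2 := by
    rintro ⟨i, j⟩
    rw [colTwo, mem_ofRowLens]
    constructor
    · rintro ⟨hi, hj⟩
      simp at hi
      interval_cases i <;> simp at hj ⊢ <;> exact hj
    · rintro ⟨hj, hi⟩
      simp only at hi hj
      subst hj
      interval_cases i <;> simp
  have h0 : colTwo.colLen 0 = 2 := by
    have h1 := mem_iff_lt_colLen.symm.trans (hmem (1, 0))
    have h2 := mem_iff_lt_colLen.symm.trans (hmem (2, 0))
    simp at h1 h2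
    omega
  have h1 : colTwo.rowLen 0 ≤ 1 := by
    have h1 := mem_iff_lt_rowLen.symm.trans (hmem (0, 1))
    simp at h1
    omega
  rw [schur, det_complete_eq_det_elem colTwo le_rfl h1, det_fin_one]
  simp [h0]

theorem transpose_colTwo : colTwo.transpose = rowTwo := by
  ext ⟨i, j⟩
  rw [mem_cells, mem_cells, mem_transpose, colTwo, rowTwo, mem_ofRowLens, mem_ofRowLens]
  simp only [Prod.swap_prod_mk, List.length_cons, List.length_nil]
  constructor
  · rintro ⟨hj, hi⟩
    interval_cases j <;> simp at hi ⊢ <;> exact hi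
  · rintro ⟨hi, hj⟩
    obtain rfl : i = 0 := by omega
    simp at hj
    interval_cases j <;> simp

end SymFun

/-- The kernels of the iterates stabilize, say at `f ^ n`. An element of the kernel has the form
`f^n y`; then `y` lies in the kernel of `f ^ (n + 1)`, hence in that of `f ^ n`. -/
theorem RingHom.injective_of_surjective_of_isNoetherianRing {R : Type*} [CommRing R]
    [IsNoetherianRing R] (f : R →+* R) (hf : Function.Surjective f) : Function.Injective f := by
  let I : ℕ →o Ideal R := ⟨fun n => RingHom.ker (f ^ n), monotone_nat_of_le_succ fun n x hx => by
    rw [RingHom.mem_ker, RingHom.coe_pow] at hx ⊢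
    rw [Function.iterate_succ_apply', hx, map_zero]⟩
  obtain ⟨n, hn⟩ := monotone_stabilizes_iff_noetherian.2 ‹IsNoetherianRing R› I
  rw [injective_iff_map_eq_zero]
  intro x hx
  obtain ⟨y, rfl⟩ := hf.iterate n x
  have hy : y ∈ I (n + 1) := by
    change y ∈ RingHom.ker (f ^ (n + 1))
    rw [RingHom.mem_ker, RingHom.coe_pow, Function.iterate_succ_apply', hx]
  rw [← hn (n + 1) n.le_succ] at hy
  change y ∈ RingHom.ker (f ^ n) at hy
  rwa [RingHom.mem_ker, RingHom.coe_pow] at hy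

/-! ### Finite alphabets and the bialternant formula -/

namespace SymFun

open MvPolynomial Finset Matrix YoungDiagram

section Alphabet

variable {R : Type*} [CommRing R]

theorem mk_pow_mul_one_sub (a : R) :
    (PowerSeries.mk fun n => a ^ n) * (1 - PowerSeries.C a * PowerSeries.X) = 1 := by
  ext n
  cases n with
  | zero => simp [mul_sub]
  | succ n =>
    rw [mul_sub, mul_one, map_sub, PowerSeries.coeff_mk, mul_comm, mul_assoc,
      PowerSeries.coeff_C_mul, mul_comm PowerSeries.X, PowerSeries.coeff_succ_mul_X,
      PowerSeries.coeff_mk, PowerSeries.coeff_one, if_neg n.succ_ne_zero]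
    ring

theorem coeff_prod_one_sub_eq_zero {ι : Type*} (s : Finset ι) (y : ι → R) {q : ℕ}
    (hq : s.card < q) :
    PowerSeries.coeff q (∏ i ∈ s, (1 - PowerSeries.C (y i) * PowerSeries.X)) = 0 := by
  classical
  induction s using Finset.induction_on generalizing q with
  | empty => simp at hq; simp [PowerSeries.coeff_one, hq.ne']
  | insert a s ha ih =>
    rw [card_insert_of_notMem ha] at hq
    obtain ⟨q, rfl⟩ : ∃ r, q = r + 1 := ⟨q - 1, by omega⟩
    rw [prod_insert ha, sub_mul, one_mul, map_sub, mul_assoc, PowerSeries.coeff_C_mul,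
      mul_comm PowerSeries.X, PowerSeries.coeff_succ_mul_X, ih (by omega), ih (by omega)]
    simp

variable [Algebra ℚ R]

/-- The specialization of symmetric functions at a finite alphabet. -/
noncomputable def evalAt {n : ℕ} (x : Fin n → R) : SymFun ℚ →ₐ[ℚ] R :=
  aeval fun r => ∑ i, x i ^ (r : ℕ)

theorem evalAt_X {n : ℕ} (x : Fin n → R) (k : ℕ) :
    evalAt x (X (Nat.succPNat k)) = ∑ i, x i ^ (k + 1) := by
  rw [evalAt, aeval_X]
  simp

/-- The alternant `det (x_k ^ β_i)`. -/
def alternant {n : ℕ} (x : Fin n → R) (β : Fin n → ℕ) : R :=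
  det (of fun i k => x k ^ β i)

/-- The exponents of the alternant of a partition. -/
def betaNumbers (n : ℕ) (μ : YoungDiagram) (i : Fin n) : ℕ := μ.rowLen i + (n - 1 - i)

/-- Compare coefficients in 1/(1 - x_k t) = H(t) ∏_{l ≠ k} (1 - x_l t). The product has degree below
n, so only n coefficients occur. -/
theorem pow_eq_sum_complete {n : ℕ} (x : Fin n → R) (k : Fin n) (b : ℕ) :
    x k ^ b = ∑ j : Fin n, (if n - 1 - (j : ℕ) ≤ b then
        evalAt x (complete ℚ (b - (n - 1 - j))) else 0) *
      PowerSeries.coeff (n - 1 - j)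
        (∏ l ∈ univ.erase k, (1 - PowerSeries.C (x l) * PowerSeries.X)) := by
  set c := ∏ l ∈ univ.erase k, (1 - PowerSeries.C (x l) * PowerSeries.X) with hc
  have h1 := completeSeries_mul_prod (evalAt x : SymFun ℚ →+* R) x (evalAt_X x)
  rw [← mul_prod_erase _ _ (mem_univ k), ← hc] at h1
  have h2 : (PowerSeries.mk fun n => x k ^ n) = completeSeries (evalAt x : SymFun ℚ →+* R) * c := by
    calc (PowerSeries.mk fun n => x k ^ n) = (PowerSeries.mk fun n => x k ^ n) *
        (completeSeries (evalAt x : SymFun ℚ →+* R) *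
          ((1 - PowerSeries.C (x k) * PowerSeries.X) * c)) := by rw [h1, mul_one]
      _ = (PowerSeries.mk fun n => x k ^ n) * (1 - PowerSeries.C (x k) * PowerSeries.X) *
        (completeSeries (evalAt x : SymFun ℚ →+* R) * c) := by ring
      _ = _ := by rw [mk_pow_mul_one_sub, one_mul]
  have h3 := congrArg (PowerSeries.coeff b) h2
  rw [PowerSeries.coeff_mk, mul_comm, PowerSeries.coeff_mul,
    Finset.Nat.sum_antidiagonal_eq_sum_range_succ (fun i j => PowerSeries.coeff i c *
      PowerSeries.coeff j (completeSeries (evalAt x : SymFun ℚ →+* R)))] at h3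
  simp only [completeSeries, PowerSeries.coeff_mk, RingHom.coe_coe] at h3
  have hcz : ∀ q, n ≤ q → PowerSeries.coeff q c = 0 := fun q hq =>
    coeff_prod_one_sub_eq_zero _ _ (by
      rw [card_erase_of_mem (mem_univ k), card_univ, Fintype.card_fin]
      have := k.2
      omega)
  rw [h3, Fin.sum_univ_eq_sum_range (fun j => (if n - 1 - j ≤ b then
        evalAt x (complete ℚ (b - (n - 1 - j))) else 0) * PowerSeries.coeff (n - 1 - j) c),
    sum_range_reflect (fun j => (if j ≤ b then
        evalAt x (complete ℚ (b - j)) else 0) * PowerSeries.coeff j c)]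
  trans ∑ j ∈ range (max (b + 1) n), (if j ≤ b then
        evalAt x (complete ℚ (b - j)) else 0) * PowerSeries.coeff j c
  · rw [← sum_subset (range_mono (le_max_left (b + 1) n))]
    · refine sum_congr rfl fun j hj => ?_
      rw [if_pos (by have := mem_range.1 hj; omega), mul_comm]
    · intro j _ hj
      rw [if_neg (fun h => hj (mem_range.2 (by omega))), zero_mul]
  · symm
    refine sum_subset (range_mono (le_max_right (b + 1) n)) fun j _ hj => ?_
    rw [hcz j (by rw [mem_range] at hj; omega), mul_zero]

/-- By `pow_eq_sum_complete` the matrix (x_k^{β_i}) is a matrix of h's times a matrix independent of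
β. For β_i = n - 1 - i the first factor is unitriangular, so the second has the Vandermonde
alternant as determinant. -/
theorem alternant_eq_det_mul {n : ℕ} (x : Fin n → R) (β : Fin n → ℕ) :
    alternant x β = det (of fun i j : Fin n => if n - 1 - (j : ℕ) ≤ β i then
        evalAt x (complete ℚ (β i - (n - 1 - j))) else 0) * alternant x (fun i => n - 1 - i) := by
  have key : ∀ β : Fin n → ℕ, alternant x β =
      det (of fun i j : Fin n => if n - 1 - (j : ℕ) ≤ β i then
        evalAt x (complete ℚ (β i - (n - 1 - j))) else 0) *
      det (of fun j k : Fin n => PowerSeries.coeff (n - 1 - j)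
        (∏ l ∈ univ.erase k, (1 - PowerSeries.C (x l) * PowerSeries.X))) := fun β => by
    rw [← det_mul, alternant]
    congr 1
    ext1 i k
    rw [mul_apply]
    exact pow_eq_sum_complete x k (β i)
  rw [key β, key fun i => n - 1 - i]
  suffices h : det (of fun i j : Fin n => if n - 1 - (j : ℕ) ≤ n - 1 - i then
      evalAt x (complete ℚ (n - 1 - i - (n - 1 - j))) else 0) = 1 by rw [h, one_mul]
  rw [det_of_isUpperTriangular, prod_eq_one]
  · intro i _
    rw [of_apply, if_pos le_rfl, Nat.sub_self, complete_zero, map_one]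
  · intro i j hij
    refine if_neg ?_
    have : (j : ℕ) < i := hij
    have := i.2
    have := j.2
    omega

/-- The bialternant formula. -/
theorem alternant_betaNumbers {n : ℕ} (x : Fin n → R) (μ : YoungDiagram) (hn : μ.colLen 0 ≤ n) :
    alternant x (betaNumbers n μ) =
      evalAt x (schur ℚ μ) * alternant x (fun i => n - 1 - i) := by
  rw [alternant_eq_det_mul, schur_eq_det μ hn, AlgHom.map_det]
  congr 2
  ext1 i j
  simp only [AlgHom.mapMatrix_apply, Matrix.map_apply, of_apply]
  have hb : betaNumbers n μ i = μ.rowLen i + (n - 1 - i) := rfl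
  have := i.2
  have := j.2
  by_cases h : (i : ℕ) ≤ μ.rowLen i + j
  · rw [if_pos h, if_pos (by omega)]
    congr 2
    omega
  · rw [if_neg h, if_neg (by omega), map_zero]

end Alphabet

/-- The power sums p_1, …, p_n in n variables are algebraically independent over ℚ. By Newton's
identities they generate the e_k, hence all symmetric polynomials. Identifying these with a
polynomial ring in n variables yields a surjective endomorphism of a Noetherian ring, which is
injective. -/
theorem aeval_psum_injective (n : ℕ) : Function.Injective
    (aeval (fun i : Fin n => psum (Fin n) ℚ (i + 1)) :
      MvPolynomial (Fin n) ℚ →ₐ[ℚ] MvPolynomial (Fin n) ℚ) := by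
  let g : MvPolynomial (Fin n) ℚ →ₐ[ℚ] symmetricSubalgebra (Fin n) ℚ :=
    aeval fun i : Fin n => ⟨psum (Fin n) ℚ (i + 1), psum_isSymmetric _ _ _⟩
  have hg : ∀ f, (g f : MvPolynomial (Fin n) ℚ) =
      aeval (fun i : Fin n => psum (Fin n) ℚ (i + 1)) f := by
    intro f
    have : (Subalgebra.val _).comp g = aeval (fun i : Fin n => psum (Fin n) ℚ (i + 1)) := by
      ext i : 1
      simp [g]
    exact DFunLike.congr_fun this f
  let E := esymmAlgEquiv (Fin n) ℚ (Fintype.card_fin n)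
  have hesymm : ∀ k, k ≤ n → ∃ f, (g f : MvPolynomial (Fin n) ℚ) = esymm (Fin n) ℚ k := by
    intro k
    induction k using Nat.strong_induction_on with
    | _ k ih =>
      intro hk
      rcases Nat.eq_zero_or_pos k with rfl | hpos
      · exact ⟨1, by simp⟩
      · have hmem : esymm (Fin n) ℚ k ∈ g.range.map (Subalgebra.val _) := by
          have h := mul_esymm_eq_sum (Fin n) ℚ k
          have h' : esymm (Fin n) ℚ k = (k : ℚ)⁻¹ • ((k : MvPolynomial (Fin n) ℚ) *
              esymm (Fin n) ℚ k) := by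
            rw [← nsmul_eq_mul, ← Nat.cast_smul_eq_nsmul ℚ, smul_smul,
              inv_mul_cancel₀ (by positivity), one_smul]
          rw [h', h]
          refine Subalgebra.smul_mem _ (Subalgebra.mul_mem _ (Subalgebra.pow_mem _
            (Subalgebra.neg_mem _ (Subalgebra.one_mem _)) _) (Subalgebra.sum_mem _ ?_)) _
          rintro ⟨a, b⟩ hab
          simp only [mem_filter, HasAntidiagonal.mem_antidiagonal] at hab
          refine Subalgebra.mul_mem _ (Subalgebra.mul_mem _ (Subalgebra.pow_mem _
            (Subalgebra.neg_mem _ (Subalgebra.one_mem _)) _) ?_) ?_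
          · obtain ⟨f, hf⟩ := ih a hab.2 (by omega)
            exact ⟨g f, ⟨f, rfl⟩, hf⟩
          · refine ⟨g (X ⟨b - 1, by omega⟩), ⟨_, rfl⟩, ?_⟩
            have : b - 1 + 1 = b := by omega
            simp [g, this]
        obtain ⟨_, ⟨f, rfl⟩, hf⟩ := hmem
        exact ⟨f, hf⟩
  have hsurj : Function.Surjective (E.symm.toAlgHom.comp g) := by
    intro f
    have hle : (⊤ : Subalgebra ℚ (MvPolynomial (Fin n) ℚ)) ≤ (E.symm.toAlgHom.comp g).range := by
      rw [← adjoin_range_X, Algebra.adjoin_le_iff]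
      rintro _ ⟨i, rfl⟩
      obtain ⟨f, hf⟩ := hesymm (i + 1) i.2
      refine ⟨f, ?_⟩
      have : g f = ⟨esymm (Fin n) ℚ (i + 1), esymm_isSymmetric _ _ _⟩ := Subtype.ext hf
      have h2 := esymmAlgEquiv_symm_apply (R := ℚ) (σ := Fin n) (Fintype.card_fin n) i
      rw [← this] at h2
      exact h2
    exact hle (Algebra.mem_top (x := f))
  have hinj := RingHom.injective_of_surjective_of_isNoetherianRing
    (E.symm.toAlgHom.comp g).toRingHom hsurj
  intro a b hab
  apply hinj
  have : g a = g b := Subtype.ext (by rw [hg, hg, hab])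
  change E.symm (g a) = E.symm (g b)
  rw [this]

/-- A symmetric function that vanishes on all large generic alphabets is zero. -/
theorem eq_of_evalAt_eq {f g : SymFun ℚ} (n₀ : ℕ)
    (h : ∀ n, n₀ ≤ n → evalAt (X : Fin n → MvPolynomial (Fin n) ℚ) f = evalAt X g) : f = g := by
  rw [← sub_eq_zero]
  obtain ⟨n, hn⟩ : ∃ n, ∀ r ∈ (f - g).vars, (r : ℕ) ≤ n := by
    refine ⟨(f - g).vars.sup fun r => (r : ℕ), fun r hr => ?_⟩
    exact le_sup (f := fun r : ℕ+ => (r : ℕ)) hr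
  let N := max n₀ n
  obtain ⟨q, hq⟩ := exists_rename_eq_of_vars_subset_range (f - g)
    (fun i : Fin N => Nat.succPNat i)
    (fun i j hij => Fin.ext (Nat.succPNat_injective hij)) (by
      intro r hr
      have := hn r hr
      have h1 := r.pos
      refine ⟨⟨r - 1, by omega⟩, ?_⟩
      apply PNat.eq
      rw [Nat.succPNat_coe]
      simp only [Nat.succ_eq_add_one]
      omega)
  rw [← hq]
  have h0 : evalAt (X : Fin N → MvPolynomial (Fin N) ℚ) (f - g) = 0 := by
    rw [map_sub, h N (le_max_left _ _), sub_self]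
  rw [← hq, evalAt, aeval_rename] at h0
  have : q = 0 := aeval_psum_injective N (by
    rw [map_zero, ← h0]
    congr 2
    )
  rw [this, map_zero]

end SymFun

/-! ### Vertical strips and the Pieri rule -/

namespace YoungDiagram

open Finset

/-- The Young diagram with given row lengths. -/
def ofAntitone (f : ℕ → ℕ) (n : ℕ) (hf : Antitone f) : YoungDiagram where
  cells := (range n ×ˢ range (f 0)).filter fun c => c.2 < f c.1
  isLowerSet := by
    rintro ⟨i, j⟩ ⟨i', j'⟩ hle h
    obtain ⟨h1, h2⟩ := Prod.mk_le_mk.1 hle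
    simp only [coe_filter, mem_product, mem_range, Set.mem_ofPred_eq] at h ⊢
    have := hf h1
    omega

theorem rowLen_ofAntitone {f : ℕ → ℕ} {n : ℕ} (hf : Antitone f) (hn : f n = 0) (i : ℕ) :
    (ofAntitone f n hf).rowLen i = f i := by
  have h : ∀ j, j < (ofAntitone f n hf).rowLen i ↔ j < f i := fun j => by
    rw [← mem_iff_lt_rowLen, ← mem_cells]
    simp only [ofAntitone, mem_filter, mem_product, mem_range]
    refine ⟨fun h => h.2, fun h => ⟨⟨?_, h.trans_le (hf (Nat.zero_le i))⟩, h⟩⟩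
    by_contra hi
    have := hf (not_lt.1 hi)
    omega
  have h1 := h (f i)
  have h2 := h ((ofAntitone f n hf).rowLen i)
  omega

theorem mem_partitionsOf {n : ℕ} {μ : YoungDiagram} : μ ∈ partitionsOf n ↔ μ.card = n := by
  simp [partitionsOf]

theorem card_eq_sum_fin_rowLen (μ : YoungDiagram) {n : ℕ} (hn : μ.colLen 0 ≤ n) :
    μ.card = ∑ i : Fin n, μ.rowLen i := by
  rw [card_eq_sum_rowLen μ hn, ← Fin.sum_univ_eq_sum_range]

/-- The skew diagram `ν / μ` is a vertical strip. -/
def IsVerticalStrip (μ ν : YoungDiagram) : Prop :=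
  ∀ i, μ.rowLen i ≤ ν.rowLen i ∧ ν.rowLen i ≤ μ.rowLen i + 1

theorem colLen_zero_le_of_rowLen_eq_zero {μ : YoungDiagram} {n : ℕ} (h : μ.rowLen n = 0) :
    μ.colLen 0 ≤ n := by
  have := lt_rowLen_iff_lt_colLen (μ := μ) (i := n) (j := 0)
  omega

/-- Every new row costs at least one new cell. This bounds the number of variables that the Pieri
rule needs. -/
theorem IsVerticalStrip.colLen_zero_le {μ ν : YoungDiagram} (h : IsVerticalStrip μ ν) :
    ν.colLen 0 + μ.card ≤ μ.colLen 0 + ν.card := by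
  set n := ν.colLen 0 + μ.colLen 0
  rw [μ.card_eq_sum_rowLen (n := n) (by omega), ν.card_eq_sum_rowLen (n := n) (by omega)]
  by_cases hle : ν.colLen 0 ≤ μ.colLen 0
  · have := sum_le_sum (s := range n) fun i _ => (h i).1
    omega
  · have h1 : ∑ i ∈ range n, (μ.rowLen i + if i ∈ Ico (μ.colLen 0) (ν.colLen 0) then 1 else 0) ≤
        ∑ i ∈ range n, ν.rowLen i := by
      refine sum_le_sum fun i _ => ?_
      split_ifs with hi
      · rw [mem_Ico] at hi
        rw [rowLen_eq_zero hi.1]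
        have := lt_rowLen_iff_lt_colLen (μ := ν) (i := i) (j := 0)
        omega
      · exact (h i).1
    rw [sum_add_distrib, sum_ite_mem, inter_eq_right.2 (fun i hi => by
      rw [mem_Ico] at hi; exact mem_range.2 (by omega))] at h1
    simp at h1
    omega

end YoungDiagram

namespace SymFun

open Finset Matrix YoungDiagram

section Alphabet

variable {R : Type*} [CommRing R]

/-- The increment of a function along a set. -/
def addIndicator {n : ℕ} (β : Fin n → ℕ) (s : Finset (Fin n)) (i : Fin n) : ℕ :=
  β i + if i ∈ s then 1 else 0

/-- Multiply column k of the alternant by 1 + x_k X and expand by multilinearity in the rows: the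
set s records the rows in which the exponent was raised. -/
theorem prod_mul_alternant {n : ℕ} (x : Fin n → R) (β : Fin n → ℕ) :
    (∏ k, (1 + PowerSeries.C (x k) * PowerSeries.X)) * PowerSeries.C (alternant x β) =
      ∑ s : Finset (Fin n), PowerSeries.X ^ s.card *
        PowerSeries.C (alternant x (addIndicator β s)) := by
  have h1 := det_mul_row (fun k => 1 + PowerSeries.C (x k) * PowerSeries.X)
    (of fun i k => PowerSeries.C (x k ^ β i))
  have h2 : det (of fun i k => PowerSeries.C (x k ^ β i)) = PowerSeries.C (alternant x β) := by
    rw [alternant, RingHom.map_det]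
    rfl
  rw [h2] at h1
  rw [← h1]
  have h3 : (of fun i k => (1 + PowerSeries.C (x k) * PowerSeries.X) *
      (of fun i k => PowerSeries.C (x k ^ β i)) i k : Matrix (Fin n) (Fin n) (PowerSeries R)) =
      (fun i k => PowerSeries.X * PowerSeries.C (x k ^ (β i + 1))) +
        fun i k => PowerSeries.C (x k ^ β i) := by
    ext1 i k
    change _ = PowerSeries.X * PowerSeries.C (x k ^ (β i + 1)) + PowerSeries.C (x k ^ β i)
    simp only [of_apply, pow_succ, map_mul]
    ring
  rw [h3]
  have h4 := (detRowAlternating (R := PowerSeries R) (n := Fin n)).map_add_univ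
    (fun i k => PowerSeries.X * PowerSeries.C (x k ^ (β i + 1)))
    (fun i k => PowerSeries.C (x k ^ β i))
  refine h4.trans (sum_congr rfl fun s _ => ?_)
  have h5 := det_mul_column (fun i => if i ∈ s then (PowerSeries.X : PowerSeries R) else 1)
    (of fun i k => PowerSeries.C (x k ^ addIndicator β s i))
  have h6 : det (of fun i k => PowerSeries.C (x k ^ addIndicator β s i)) =
      PowerSeries.C (alternant x (addIndicator β s)) := by
    rw [alternant, RingHom.map_det]
    rfl
  rw [h6, prod_ite_mem, univ_inter, prod_const] at h5
  rw [← h5]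
  change det _ = _
  congr 1
  ext1 i k
  by_cases hi : i ∈ s
  · simp [hi, addIndicator]
  · simp [hi, addIndicator]

theorem alternant_eq_zero {n : ℕ} (x : Fin n → R) {β : Fin n → ℕ} {i j : Fin n} (hij : i ≠ j)
    (h : β i = β j) : alternant x β = 0 :=
  det_zero_of_row_eq hij (by ext k; simp [h])

variable [Algebra ℚ R]

theorem evalAt_elem_mul_alternant {n : ℕ} (x : Fin n → R) (β : Fin n → ℕ) (k : ℕ) :
    evalAt x (elem k) * alternant x β =
      ∑ s ∈ powersetCard k (univ : Finset (Fin n)), alternant x (addIndicator β s) := by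
  have h := completeSeries_eq_prod ((evalAt x : SymFun ℚ →+* R).comp (omega : SymFun ℚ →+* _)) x
    (fun n => by
      rw [RingHom.comp_apply, RingHom.coe_coe, RingHom.coe_coe, omega_X, map_mul, evalAt_X]
      simp)
  have h2 := congrArg (PowerSeries.coeff k) (prod_mul_alternant x β)
  rw [← h, PowerSeries.coeff_mul_C, completeSeries, PowerSeries.coeff_mk, map_sum] at h2
  refine h2.trans ?_
  rw [← univ_filter_card_eq, sum_filter]
  refine sum_congr rfl fun s _ => ?_
  rw [PowerSeries.coeff_mul_C, PowerSeries.coeff_X_pow]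
  by_cases hs : s.card = k
  · simp [hs]
  · simp [hs, Ne.symm hs]

end Alphabet

-- The exponents of μ decrease strictly, so raising some of them by 1 keeps them weakly decreasing.
-- Either two neighbours become equal and the alternant vanishes, or the result belongs to a
-- partition obtained by adding a vertical strip.
open Classical in
theorem sum_alternant_addIndicator {R : Type*} [CommRing R] {n : ℕ} (x : Fin n → R)
    (μ : YoungDiagram) (k : ℕ) (hn : μ.colLen 0 + k ≤ n) :
    ∑ s ∈ powersetCard k (univ : Finset (Fin n)), alternant x (addIndicator (betaNumbers n μ) s) =
      ∑ ν ∈ (partitionsOf (μ.card + k)).filter (IsVerticalStrip μ),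
        alternant x (betaNumbers n ν) := by
  symm
  have hcol : ∀ ν ∈ (partitionsOf (μ.card + k)).filter (IsVerticalStrip μ), ν.colLen 0 ≤ n := by
    intro ν hν
    rw [mem_filter, mem_partitionsOf] at hν
    have := hν.2.colLen_zero_le
    omega
  have hrow : ∀ ν ∈ (partitionsOf (μ.card + k)).filter (IsVerticalStrip μ), ∀ i : Fin n,
      ν.rowLen i = μ.rowLen i + if ν.rowLen i = μ.rowLen i + 1 then 1 else 0 := by
    intro ν hν i
    have := (mem_filter.1 hν).2 i
    split_ifs <;> omega
  refine sum_of_injOn (fun ν => univ.filter fun i : Fin n => ν.rowLen i = μ.rowLen i + 1)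
    ?_ ?_ ?_ ?_
  · intro ν hν ρ hρ h
    refine ext_rowLen fun i => ?_
    by_cases hi : i < n
    · have h1 := hrow ν hν ⟨i, hi⟩
      have h2 := hrow ρ hρ ⟨i, hi⟩
      have h3 := Finset.ext_iff.1 h ⟨i, hi⟩
      simp only [mem_filter, mem_univ, true_and] at h1 h2 h3
      simp only [h3] at h1
      omega
    · rw [rowLen_eq_zero ((hcol ν hν).trans (not_lt.1 hi)),
        rowLen_eq_zero ((hcol ρ hρ).trans (not_lt.1 hi))]
  · intro ν hν
    rw [mem_coe, mem_powersetCard]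
    refine ⟨subset_univ _, ?_⟩
    have h1 := (mem_partitionsOf.1 (mem_filter.1 hν).1)
    rw [card_eq_sum_fin_rowLen ν (hcol ν hν), card_eq_sum_fin_rowLen μ (n := n) (by omega),
      sum_congr rfl (fun i _ => hrow ν hν i), sum_add_distrib] at h1
    rw [card_filter]
    omega
  · intro s hs hns
    by_contra hne
    apply hns
    let f : ℕ → ℕ := fun i => μ.rowLen i + if h : i < n then (if ⟨i, h⟩ ∈ s then 1 else 0) else 0
    have hf : Antitone f := by
      refine antitone_nat_of_succ_le fun i => ?_
      by_contra hlt
      apply hne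
      have h1 := μ.rowLen_anti i (i + 1) (by omega)
      have hi : i + 1 < n := by
        by_contra hi
        simp only [f, dif_neg hi] at hlt
        omega
      have hi' : i < n := by omega
      refine alternant_eq_zero x (i := ⟨i, hi'⟩) (j := ⟨i + 1, hi⟩) (by simp) ?_
      simp only [f, dif_pos hi, dif_pos hi'] at hlt
      simp only [addIndicator, betaNumbers]
      split_ifs at hlt ⊢ <;> omega
    have hfn : f n = 0 := by
      simp only [f, dif_neg (lt_irrefl n)]
      rw [rowLen_eq_zero (by omega)]
    have hrl := rowLen_ofAntitone hf hfn
    have hs' : ∀ i : Fin n, f i = μ.rowLen i + if i ∈ s then 1 else 0 := fun i => by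
      simp [f]
    refine ⟨ofAntitone f n hf, ?_, ?_⟩
    · rw [mem_coe, mem_filter, mem_partitionsOf]
      constructor
      · rw [card_eq_sum_fin_rowLen (n := n) _
          (colLen_zero_le_of_rowLen_eq_zero ((hrl n).trans hfn)),
          card_eq_sum_fin_rowLen μ (n := n) (by omega)]
        simp only [hrl, hs', sum_add_distrib]
        simp [(mem_powersetCard.1 hs).2]
      · intro i
        rw [hrl]
        simp only [f]
        split_ifs <;> omega
    · ext i
      simp only [mem_filter, mem_univ, true_and, hrl, hs']
      by_cases hi : i ∈ s <;> simp [hi]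
  · intro ν hν
    congr 1
    ext i
    simp only [betaNumbers, addIndicator, mem_filter, mem_univ, true_and]
    have := hrow ν hν i
    omega

theorem alternant_X_ne_zero (n : ℕ) : alternant (MvPolynomial.X : Fin n → MvPolynomial (Fin n) ℚ)
    (fun i => n - 1 - i) ≠ 0 := by
  have h : (of fun i k : Fin n => (MvPolynomial.X k : MvPolynomial (Fin n) ℚ) ^ (n - 1 - (i : ℕ))) =
      ((vandermonde (MvPolynomial.X : Fin n → MvPolynomial (Fin n) ℚ))ᵀ).submatrix
        Fin.revPerm id := by
    ext1 i k
    simp only [of_apply, submatrix_apply, transpose_apply, vandermonde_apply, id,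
      Fin.revPerm_apply, Fin.val_rev]
    congr 1
    omega
  rw [alternant, h, det_permute, det_transpose]
  refine mul_ne_zero ?_ (det_vandermonde_ne_zero_iff.2 (MvPolynomial.X_injective))
  rcases Int.units_eq_one_or (Equiv.Perm.sign (Fin.revPerm (n := n))) with h | h <;> simp [h]

open Classical in
/-- The Pieri rule for vertical strips. -/
theorem elem_mul_schur (k : ℕ) (μ : YoungDiagram) :
    elem k * schur ℚ μ =
      ∑ ν ∈ (partitionsOf (μ.card + k)).filter (IsVerticalStrip μ), schur ℚ ν := by
  refine eq_of_evalAt_eq (μ.colLen 0 + k) fun n hn => ?_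
  apply mul_right_cancel₀ (alternant_X_ne_zero n)
  rw [map_mul, mul_assoc, ← alternant_betaNumbers _ _ (by omega), evalAt_elem_mul_alternant,
    sum_alternant_addIndicator _ _ _ hn, map_sum, sum_mul]
  refine sum_congr rfl fun ν hν => alternant_betaNumbers _ _ ?_
  rw [mem_filter, mem_partitionsOf] at hν
  have := hν.2.colLen_zero_le
  omega

end SymFun

/-! ### The type D denominator identity and e_h[e_2] on an alphabet -/

namespace SymFun

open Finset Matrix YoungDiagram

section Denominator

variable {F : Type*} [Field F]

/-- These are Chebyshev-like polynomials: with v = a/u, the power sum u^y + v^y is a polynomial in u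
+ v and uv = a, built by the recursion of step two. -/
theorem exists_monic_eval_add_div (a : F) (y : ℕ) :
    ∃ p : Polynomial F, p.Monic ∧ p.natDegree = y ∧
      ∀ u : F, u ≠ 0 → p.eval (u + a / u) = u ^ y + if y = 0 then 0 else (a / u) ^ y := by
  induction y using Nat.twoStepInduction with
  | zero => exact ⟨1, Polynomial.monic_one, Polynomial.natDegree_one, by simp⟩
  | one => exact ⟨Polynomial.X, Polynomial.monic_X, Polynomial.natDegree_X, by simp⟩
  | more y ih1 ih2 =>
    obtain ⟨p, hp, hpd, hpe⟩ := ih1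
    obtain ⟨q, hq, hqd, hqe⟩ := ih2
    -- The polynomial of index 0 is 1 instead of u^0 + v^0 = 2, so the first step of the recursion
    -- needs the factor 2.
    obtain ⟨b, hb⟩ : ∃ b : F, b = if y = 0 then 2 * a else a := ⟨_, rfl⟩
    have hdeg : (Polynomial.X * q).natDegree = y + 2 := by
      rw [Polynomial.natDegree_X_mul hq.ne_zero, hqd]
    have hlt : (Polynomial.C b * p).natDegree < (Polynomial.X * q).natDegree := by
      rw [hdeg]
      exact (Polynomial.natDegree_C_mul_le b p).trans_lt (by omega)
    refine ⟨Polynomial.X * q - Polynomial.C b * p, ?_, ?_, fun u hu => ?_⟩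
    · exact (Polynomial.monic_X.mul hq).sub_of_left (Polynomial.degree_lt_degree hlt)
    · rw [Polynomial.natDegree_sub_eq_left_of_natDegree_lt hlt, hdeg]
    · have hua : a = u * (a / u) := by field_simp
      rw [Polynomial.eval_sub, Polynomial.eval_mul, Polynomial.eval_X, Polynomial.eval_mul,
        Polynomial.eval_C, hpe u hu, hqe u hu, hb]
      generalize a / u = v at hua ⊢
      subst hua
      rw [if_neg (Nat.succ_ne_zero y), if_neg (Nat.succ_ne_zero (y + 1))]
      split_ifs with h
      · subst h
        ring
      · ring

/-- The Weyl denominator identity of type `D`, deformed. -/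
theorem det_add_pow_eq_prod_mul_of_field {N : ℕ} (x : Fin (N + 1) → F) (hx : ∀ k, x k ≠ 0)
    (T : F) :
    det (of fun y k : Fin (N + 1) => x k ^ (N - (y : ℕ)) +
        (if (y : ℕ) = 0 then 0 else (-T) ^ (y : ℕ)) * x k ^ (N + (y : ℕ))) =
      (∏ i, ∏ j ∈ Ioi i, (1 + T * (x i * x j))) *
        alternant x (fun y => N - (y : ℕ)) := by
  -- After x_k^N is taken out of column k, the entries are monic polynomials of degree y in z_k =
  -- 1/x_k - T x_k. The determinant is therefore Vandermonde in the z_k, and z_j - z_i = (x_i -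
  -- x_j)(1 + T x_i x_j)/(x_i x_j).
  have key : ∀ T : F, det (of fun y k : Fin (N + 1) => x k ^ (N - (y : ℕ)) +
        (if (y : ℕ) = 0 then 0 else (-T) ^ (y : ℕ)) * x k ^ (N + (y : ℕ))) =
      (∏ i, ∏ j ∈ Ioi i, (1 + T * (x i * x j))) *
        ((∏ k, x k ^ N) * ∏ i, ∏ j ∈ Ioi i, ((x i - x j) * (x i * x j)⁻¹)) := fun T => by
    choose p hp hpd hpe using exists_monic_eval_add_div (-T)
    have h1 := det_eval_matrixOfPolynomials_eq_det_vandermonde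
      (fun k => (x k)⁻¹ + -T / (x k)⁻¹) (fun y : Fin (N + 1) => p y) (fun y => hpd y)
      (fun y => hp y)
    have h2 := det_mul_row (fun k => x k ^ N)
      (of fun k y : Fin (N + 1) => (p y).eval ((x k)⁻¹ + -T / (x k)⁻¹))ᵀ
    rw [det_transpose, ← h1, det_vandermonde] at h2
    rw [mul_left_comm, ← prod_mul_distrib]
    trans (of fun i j => (fun k => x k ^ N) j *
      (of fun k y : Fin (N + 1) => (p y).eval ((x k)⁻¹ + -T / (x k)⁻¹))ᵀ i j).det
    · congr 1
      ext1 y k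
      have hy : (y : ℕ) ≤ N := Nat.lt_succ_iff.1 y.2
      have hxk := hx k
      simp only [of_apply, transpose_apply]
      rw [hpe _ _ (inv_ne_zero hxk), mul_add, pow_add]
      congr 1
      · rw [inv_pow, pow_sub₀ _ hxk hy]
      · split_ifs
        · simp
        · rw [div_inv_eq_mul, mul_pow]
          ring
    · rw [h2]
      congr 1
      refine prod_congr rfl fun i _ => ?_
      rw [← prod_mul_distrib]
      refine prod_congr rfl fun j _ => ?_
      have := hx i
      have := hx j
      field_simp
      ring
  rw [key T]
  congr 1
  -- The factor without T is identified by setting T = 0, where the matrix is that of the alternant.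
  have h0 := key 0
  simp only [zero_mul, add_zero, prod_const_one, one_mul] at h0
  rw [← h0, alternant]
  congr 1
  ext1 y k
  simp only [of_apply]
  split_ifs with h
  · simp
  · simp [h]

end Denominator

theorem det_add_pow_eq_prod_mul_of_injective {R F : Type*} [CommRing R] [Field F] [Algebra R F]
    (hinj : Function.Injective (algebraMap R F)) {N : ℕ}
    (x : Fin (N + 1) → R) (hx : ∀ k, x k ≠ 0) (T : R) :
    det (of fun y k : Fin (N + 1) => x k ^ (N - (y : ℕ)) +
        (if (y : ℕ) = 0 then 0 else (-T) ^ (y : ℕ)) * x k ^ (N + (y : ℕ))) =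
      (∏ i, ∏ j ∈ Ioi i, (1 + T * (x i * x j))) *
        alternant x (fun y => N - (y : ℕ)) := by
  apply hinj
  have := det_add_pow_eq_prod_mul_of_field (fun k => algebraMap R F (x k))
    (fun k => (map_ne_zero_iff _ hinj).2 (hx k)) (algebraMap R F T)
  rw [RingHom.map_det, map_mul, map_prod, alternant, RingHom.map_det]
  simp only [map_prod, map_add, map_mul, map_one]
  rw [alternant] at this
  have h1 : (algebraMap R F).mapMatrix (of fun y k : Fin (N + 1) => x k ^ (N - (y : ℕ)) +
        (if (y : ℕ) = 0 then 0 else (-T) ^ (y : ℕ)) * x k ^ (N + (y : ℕ))) =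
      of fun y k : Fin (N + 1) => algebraMap R F (x k) ^ (N - (y : ℕ)) +
        (if (y : ℕ) = 0 then 0 else (-algebraMap R F T) ^ (y : ℕ)) *
          algebraMap R F (x k) ^ (N + (y : ℕ)) := by
    ext1 y k
    simp only [RingHom.mapMatrix_apply, Matrix.map_apply, of_apply, map_add, map_mul, map_pow]
    by_cases hy : (y : ℕ) = 0
    · rw [if_pos hy, if_pos hy, map_zero]
    · rw [if_neg hy, if_neg hy, map_pow, map_neg]
  have h2 : (algebraMap R F).mapMatrix (of fun i k : Fin (N + 1) => x k ^ (N - (i : ℕ))) =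
      of fun i k : Fin (N + 1) => algebraMap R F (x k) ^ (N - (i : ℕ)) := by
    ext1 y k
    simp
  rw [h1, h2, this]

/-- The parameter T will be the variable of a power series ring, hence the passage from fields to
domains. -/
theorem det_add_pow_eq_prod_mul {R : Type*} [CommRing R] [IsDomain R] {N : ℕ}
    (x : Fin (N + 1) → R) (hx : ∀ k, x k ≠ 0) (T : R) :
    det (of fun y k : Fin (N + 1) => x k ^ (N - (y : ℕ)) +
        (if (y : ℕ) = 0 then 0 else (-T) ^ (y : ℕ)) * x k ^ (N + (y : ℕ))) =
      (∏ i, ∏ j ∈ Ioi i, (1 + T * (x i * x j))) *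
        alternant x (fun y => N - (y : ℕ)) :=
  det_add_pow_eq_prod_mul_of_injective (IsFractionRing.injective R (FractionRing R)) x hx T

/-- The exponents `N + y` for `y ∈ s` and `N - y` for `y ∉ s`. -/
def flipExponents (N : ℕ) (s : Finset (Fin (N + 1))) (y : Fin (N + 1)) : ℕ :=
  if y ∈ s then N + y else N - y

/-- Expand the denominator determinant by rows: row y contributes x^{N-y} or (-X)^y x^{N+y}. Row 0
has only the first term, whence the condition on s. -/
theorem prod_mul_alternant_eq_sum_flipExponents {R : Type*} [CommRing R] [IsDomain R] {N : ℕ}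
    (x : Fin (N + 1) → R) (hx : ∀ k, x k ≠ 0) :
    (∏ i, ∏ j ∈ Ioi i, (1 + PowerSeries.C (x i * x j) * PowerSeries.X)) *
        PowerSeries.C (alternant x (fun y => N - (y : ℕ))) =
      ∑ s ∈ univ.filter (fun s : Finset (Fin (N + 1)) => 0 ∉ s),
        (-PowerSeries.X) ^ (∑ y ∈ s, (y : ℕ)) *
          PowerSeries.C (alternant x (flipExponents N s)) := by
  have hC : ∀ β : Fin (N + 1) → ℕ, alternant (fun k => PowerSeries.C (x k)) β =
      PowerSeries.C (alternant x β) := fun β => by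
    rw [alternant, alternant, RingHom.map_det]
    congr 1
    ext1 i k
    simp
  have h1 := det_add_pow_eq_prod_mul (fun k => PowerSeries.C (x k))
    (fun k => (map_ne_zero_iff _ PowerSeries.C_injective).2 (hx k)) PowerSeries.X
  rw [hC] at h1
  have h2 : (∏ i, ∏ j ∈ Ioi i, (1 + PowerSeries.C (x i * x j) * PowerSeries.X)) =
      ∏ i, ∏ j ∈ Ioi i, (1 + PowerSeries.X * (PowerSeries.C (x i) * PowerSeries.C (x j))) :=
    prod_congr rfl fun i _ => prod_congr rfl fun j _ => by rw [map_mul, mul_comm PowerSeries.X]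
  rw [h2, ← h1]
  have h3 : (of fun y k : Fin (N + 1) => (PowerSeries.C (x k)) ^ (N - (y : ℕ)) +
        (if (y : ℕ) = 0 then 0 else (-PowerSeries.X) ^ (y : ℕ)) *
          (PowerSeries.C (x k)) ^ (N + (y : ℕ))) =
      (fun y k : Fin (N + 1) => (if (y : ℕ) = 0 then 0 else (-PowerSeries.X) ^ (y : ℕ)) *
          (PowerSeries.C (x k)) ^ (N + (y : ℕ))) +
        fun y k : Fin (N + 1) => (PowerSeries.C (x k)) ^ (N - (y : ℕ)) := by
    ext1 i k
    exact add_comm _ _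
  rw [h3]
  have h4 := (detRowAlternating (R := PowerSeries R) (n := Fin (N + 1))).map_add_univ
    (fun y k => (if (y : ℕ) = 0 then 0 else (-PowerSeries.X) ^ (y : ℕ)) *
          (PowerSeries.C (x k)) ^ (N + (y : ℕ)))
    (fun y k => (PowerSeries.C (x k)) ^ (N - (y : ℕ)))
  refine h4.trans ?_
  rw [sum_filter]
  refine sum_congr rfl fun s _ => ?_
  have h5 := det_mul_column (fun y : Fin (N + 1) => if y ∈ s then
      (if (y : ℕ) = 0 then 0 else (-PowerSeries.X : PowerSeries R) ^ (y : ℕ)) else 1)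
    (of fun y k => PowerSeries.C (x k) ^ flipExponents N s y)
  rw [← alternant, hC, prod_ite_mem, univ_inter] at h5
  trans (∏ y ∈ s, if (y : ℕ) = 0 then 0 else (-PowerSeries.X : PowerSeries R) ^ (y : ℕ)) *
    PowerSeries.C (alternant x (flipExponents N s))
  · rw [← h5]
    change det _ = _
    congr 1
    ext1 y k
    by_cases hy : y ∈ s
    · simp [hy, flipExponents]
    · simp [hy, flipExponents]
  · by_cases h0 : 0 ∈ s
    · rw [if_neg (not_not.2 h0), prod_eq_zero h0 (by simp), zero_mul]
    · rw [if_pos h0]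
      congr 1
      rw [← prod_pow_eq_pow_sum]
      refine prod_congr rfl fun y hy => if_neg fun hy0 => h0 ?_
      rwa [show (0 : Fin (N + 1)) = y from Fin.ext hy0.symm]

/-- Plethysm by a fixed symmetric function, as an algebra homomorphism. -/
noncomputable def plethysmHom (g : SymFun ℚ) : SymFun ℚ →ₐ[ℚ] SymFun ℚ :=
  MvPolynomial.aeval fun r => powerPlethysm r g

theorem plethysm_eq (f g : SymFun ℚ) : plethysm f g = plethysmHom g f := by
  rw [plethysm, plethysmHom]
  simp [MvPolynomial.map_id]

theorem two_mul_elem_two : 2 * elem 2 = MvPolynomial.X 1 ^ 2 - MvPolynomial.X 2 := by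
  have h := succ_mul_elem 1
  rw [sum_range_succ, sum_range_one, show Nat.succPNat 0 = 1 from rfl,
    show Nat.succPNat 1 = 2 from rfl] at h
  simp only [Nat.sub_self, Nat.sub_zero, elem_one, elem_zero] at h
  push_cast at h
  linear_combination h

theorem two_mul_powerPlethysm_elem_two (r : ℕ+) : 2 * powerPlethysm r (elem 2) =
    MvPolynomial.X r ^ 2 - MvPolynomial.X (r * 2) := by
  have h := congrArg (powerPlethysm r) two_mul_elem_two
  simp only [powerPlethysm, map_mul, map_sub, map_pow, MvPolynomial.rename_X, mul_one,
    map_ofNat] at h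
  exact h

theorem sq_sum_eq {R : Type*} [CommRing R] {n : ℕ} (a : Fin n → R) :
    (∑ i, a i) ^ 2 = ∑ i, a i ^ 2 + 2 * ∑ i, ∑ j ∈ Ioi i, a i * a j := by
  rw [sq, sum_mul_sum, two_mul]
  have h1 : ∀ i, ∑ j, a i * a j =
      a i ^ 2 + (∑ j ∈ Ioi i, a i * a j + ∑ j ∈ Iio i, a i * a j) := fun i => by
    rw [← filter_lt_eq_Ioi, ← filter_gt_eq_Iio, sum_filter, sum_filter, ← sum_add_distrib,
      ← sum_ite_eq univ i (fun j => a j ^ 2) |>.trans (if_pos (mem_univ i)), ← sum_add_distrib]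
    refine sum_congr rfl fun j _ => ?_
    rcases lt_trichotomy i j with h | rfl | h
    · simp [h, h.ne, h.not_gt]
    · simp [sq]
    · simp [h, h.ne', h.not_gt]
  simp only [h1, sum_add_distrib]
  congr 2
  rw [sum_comm' (t' := univ) (s' := fun j => Ioi j) (by simp)]
  exact sum_congr rfl fun i _ => sum_congr rfl fun j _ => mul_comm _ _

/-- On the alphabet x, p_r[e_2] is ∑_{i<j} (x_i x_j)^r. So e_h[e_2] is e_h evaluated at the products
x_i x_j, the coefficient of X^h in ∏_{i<j} (1 + x_i x_j X). -/
theorem evalAt_plethysmHom_elem {R : Type*} [CommRing R] [Algebra ℚ R] [IsDomain R] {N : ℕ}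
    (x : Fin (N + 1) → R) (hx : ∀ k, x k ≠ 0) (h : ℕ) :
    evalAt x (plethysmHom (elem 2) (elem h)) * alternant x (fun y => N - (y : ℕ)) =
      ∑ s ∈ univ.filter (fun s : Finset (Fin (N + 1)) => 0 ∉ s ∧ ∑ y ∈ s, (y : ℕ) = h),
        (-1) ^ h * alternant x (flipExponents N s) := by
  have h1 := completeSeries_eq_prod (((evalAt x : SymFun ℚ →+* R).comp
    (plethysmHom (elem 2) : SymFun ℚ →+* _)).comp (omega : SymFun ℚ →+* _))
    (fun p : (Σ i : Fin (N + 1), Ioi i) => x p.1 * x p.2) (fun n => by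
      simp only [RingHom.comp_apply, RingHom.coe_coe, omega_X, map_mul, map_pow, map_neg, map_one]
      congr 1
      rw [plethysmHom, MvPolynomial.aeval_X]
      have h2 : IsUnit (2 : R) := by
        have := (isUnit_iff_ne_zero.2 (two_ne_zero (α := ℚ))).map (algebraMap ℚ R)
        rwa [map_ofNat] at this
      apply h2.mul_left_cancel
      have h3 := congrArg (evalAt x) (two_mul_powerPlethysm_elem_two (Nat.succPNat n))
      rw [map_mul, map_ofNat, map_sub, map_pow, evalAt_X, sq_sum_eq] at h3
      rw [h3, evalAt, MvPolynomial.aeval_X, Fintype.sum_sigma]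
      have h4 : ∀ i : Fin (N + 1), ∑ j : Ioi i, (x i * x j) ^ (n + 1) =
          ∑ j ∈ Ioi i, x i ^ (n + 1) * x j ^ (n + 1) := fun i => by
        rw [← sum_coe_sort (Ioi i)]
        exact sum_congr rfl fun j _ => mul_pow _ _ _
      simp only [h4, PNat.mul_coe, Nat.succPNat_coe, Nat.succ_eq_add_one, ← pow_mul,
        PNat.val_ofNat]
      ring)
  rw [Fintype.prod_sigma] at h1
  have h2 : ∀ i : Fin (N + 1), ∏ j : Ioi i, (1 + PowerSeries.C (x i * x j) * PowerSeries.X) =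
      ∏ j ∈ Ioi i, (1 + PowerSeries.C (x i * x j) * PowerSeries.X) := fun i =>
    prod_coe_sort (Ioi i) fun j => (1 + PowerSeries.C (x i * x j) * PowerSeries.X)
  simp only [h2] at h1
  have h3 := prod_mul_alternant_eq_sum_flipExponents x hx
  rw [← h1] at h3
  have h4 := congrArg (PowerSeries.coeff h) h3
  rw [PowerSeries.coeff_mul_C, completeSeries, PowerSeries.coeff_mk, map_sum] at h4
  refine h4.trans ?_
  rw [← filter_filter, sum_filter (p := fun s : Finset (Fin (N + 1)) => ∑ y ∈ s, (y : ℕ) = h)]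
  refine sum_congr rfl fun s _ => ?_
  rw [PowerSeries.coeff_mul_C, neg_pow, ← map_one PowerSeries.C, ← map_neg, ← map_pow,
    PowerSeries.coeff_C_mul, PowerSeries.coeff_X_pow]
  by_cases hs : ∑ y ∈ s, (y : ℕ) = h
  · simp [hs]
  · simp [hs, Ne.symm hs]

end SymFun

/-! ### Flipped exponents, threshold partitions and Littlewood's expansion -/

namespace SymFun

open Finset Matrix YoungDiagram

theorem betaNumbers_strictAnti (n : ℕ) (μ : YoungDiagram) : StrictAnti (betaNumbers n μ) := by
  intro i j hij
  have := μ.rowLen_anti i j hij.le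
  have h : (i : ℕ) < j := hij
  have := j.2
  simp only [betaNumbers]
  omega

theorem bead_eq_betaNumbers {N : ℕ} (μ : YoungDiagram) (i : Fin (N + 1)) :
    μ.bead i = betaNumbers (N + 1) μ i - N := by
  have := i.2
  simp only [bead, betaNumbers]
  omega

theorem eq_of_image_betaNumbers_eq {n : ℕ} {μ ν : YoungDiagram} (hμ : μ.colLen 0 ≤ n)
    (hν : ν.colLen 0 ≤ n)
    (h : univ.image (betaNumbers n μ) = univ.image (betaNumbers n ν)) : μ = ν := by
  have h1 : Set.range (betaNumbers n μ ∘ Fin.rev) = Set.range (betaNumbers n ν ∘ Fin.rev) := by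
    rw [Fin.rev_surjective.range_comp, Fin.rev_surjective.range_comp]
    simpa using congrArg (fun s : Finset ℕ => (s : Set ℕ)) h
  have h2 := (StrictMono.range_inj ((betaNumbers_strictAnti n μ).comp Fin.rev_strictAnti)
    ((betaNumbers_strictAnti n ν).comp Fin.rev_strictAnti)).1 h1
  refine ext_rowLen fun i => ?_
  by_cases hi : i < n
  · have := congrFun h2 (Fin.rev ⟨i, hi⟩)
    simp only [Function.comp_apply, Fin.rev_rev, betaNumbers] at this
    omega
  · rw [rowLen_eq_zero (by omega), rowLen_eq_zero (by omega)]

/-- Every injective tuple of exponents is a rearrangement of the exponents of a partition. -/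
theorem exists_betaNumbers_comp {n : ℕ} (γ : Fin n → ℕ) (hγ : Function.Injective γ) :
    ∃ μ : YoungDiagram, μ.colLen 0 ≤ n ∧ ∃ σ : Equiv.Perm (Fin n), γ = betaNumbers n μ ∘ σ := by
  let τ : Equiv.Perm (Fin n) := Fin.revPerm.trans (Tuple.sort γ)
  have hmono : StrictMono (γ ∘ Tuple.sort γ) :=
    (Tuple.monotone_sort γ).strictMono_of_injective (hγ.comp (Tuple.sort γ).injective)
  have hτ : StrictAnti (γ ∘ τ) := hmono.comp_strictAnti Fin.rev_strictAnti
  let f : ℕ → ℕ := fun i => if h : i < n then γ (τ ⟨i, h⟩) - (n - 1 - i) else 0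
  have hle : ∀ d i (h : i < n), n - 1 - i = d → d ≤ γ (τ ⟨i, h⟩) := by
    intro d
    induction d with
    | zero => intro i h _; exact Nat.zero_le _
    | succ d ih =>
      intro i h hd
      have h1 := ih (i + 1) (by omega) (by omega)
      have h2 : γ (τ ⟨i + 1, by omega⟩) < γ (τ ⟨i, h⟩) :=
        hτ (a := ⟨i, h⟩) (b := ⟨i + 1, by omega⟩) (Fin.mk_lt_mk.2 (Nat.lt_succ_self i))
      omega
  have hf : Antitone f := by
    refine antitone_nat_of_succ_le fun i => ?_
    by_cases hi : i + 1 < n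
    · have h2 : γ (τ ⟨i + 1, hi⟩) < γ (τ ⟨i, by omega⟩) :=
        hτ (a := ⟨i, by omega⟩) (b := ⟨i + 1, hi⟩) (Fin.mk_lt_mk.2 (Nat.lt_succ_self i))
      simp only [f, dif_pos hi, dif_pos (show i < n by omega)]
      omega
    · simp only [f, dif_neg hi, Nat.zero_le]
  have hfn : f n = 0 := dif_neg (lt_irrefl n)
  have hrl := rowLen_ofAntitone hf hfn
  refine ⟨ofAntitone f n hf, colLen_zero_le_of_rowLen_eq_zero ((hrl n).trans hfn), τ.symm, ?_⟩
  funext i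
  obtain ⟨j, rfl⟩ := τ.surjective i
  have := hle _ j j.2 rfl
  simp only [Function.comp_apply, Equiv.symm_apply_apply, betaNumbers, hrl, f, dif_pos j.2,
    Fin.eta]
  simp only [Fin.eta] at this
  omega

theorem flipExponents_injective {N : ℕ} {s : Finset (Fin (N + 1))} (hs : 0 ∉ s) :
    Function.Injective (flipExponents N s) := by
  intro a b hab
  have ha := a.2
  have hb := b.2
  have h0 : ∀ c ∈ s, (c : ℕ) ≠ 0 := fun c hc h => hs (by
    rwa [show (0 : Fin (N + 1)) = c from Fin.ext h.symm])
  apply Fin.ext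
  simp only [flipExponents] at hab
  split_ifs at hab with h1 h2 h2
  · omega
  · have := h0 a h1
    omega
  · have := h0 b h2
    omega
  · omega

theorem alternant_comp_perm {R : Type*} [CommRing R] {n : ℕ} (x : Fin n → R) (β : Fin n → ℕ)
    (σ : Equiv.Perm (Fin n)) :
    alternant x (β ∘ σ) = ((Equiv.Perm.sign σ : ℤ) : R) * alternant x β := by
  rw [alternant, alternant, ← det_permute]
  rfl

/-- Flipping y from N - y to N + y moves it past exactly the y smaller indices, whether or not these
are flipped. The resulting sign cancels the (-1)^h in `evalAt_plethysmHom_elem`. -/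
theorem sign_eq_of_flipExponents_eq {N : ℕ} {s : Finset (Fin (N + 1))} {μ : YoungDiagram} {σ : Equiv.Perm (Fin (N + 1))}
    (h : flipExponents N s = betaNumbers (N + 1) μ ∘ σ) :
    (Equiv.Perm.sign σ : ℤ) = (-1) ^ (∑ y ∈ s, (y : ℕ)) := by
  have hanti := betaNumbers_strictAnti (N + 1) μ
  rw [Equiv.Perm.sign_eq_neg_one_pow_card_inversions σ (fun i => (betaNumbers (N + 1) μ i : ℤ))
    (fun i j hij => hanti.injective (Nat.cast_injective hij))]
  congr 1
  have h1 : ∀ a, betaNumbers (N + 1) μ (σ a) = flipExponents N s a := fun a => by rw [h]; rfl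
  simp only [h1, Nat.cast_lt, hanti.lt_iff_gt]
  have h2 : ∀ y : Fin (N + 1), (y : ℕ) = (Iio y).card := fun y => (Fin.card_Iio y).symm
  rw [sum_congr rfl fun y _ => h2 y, ← card_sigma]
  refine card_bij' (fun x _ => ⟨x.1, x.2⟩) (fun x _ => (x.1, x.2)) ?_ ?_ (fun _ _ => rfl)
    (fun _ _ => rfl)
  · rintro ⟨a, b⟩ hab
    replace hab := (mem_filter.1 hab).2
    simp only [flipExponents] at hab
    simp only [mem_sigma, mem_Iio]
    refine ⟨?_, hab.1⟩
    have h3 : (b : ℕ) < a := hab.1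
    by_contra ha
    have := hab.2
    rw [if_neg ha] at this
    split_ifs at this <;> omega
  · rintro ⟨a, b⟩ hab
    simp only [mem_sigma, mem_Iio] at hab
    refine mem_filter.2 ⟨mem_univ _, hab.2, ?_⟩
    simp only [flipExponents, if_pos hab.1]
    have h3 : (b : ℕ) < a := hab.2
    split_ifs <;> omega

end SymFun

namespace YoungDiagram

open Finset SymFun

theorem bead_pos_iff {μ : YoungDiagram} {i : ℕ} : 0 < μ.bead i ↔ (i, i) ∈ μ := by
  rw [mem_iff_lt_rowLen, bead]
  omega

theorem hole_nonpos_iff {μ : YoungDiagram} {i : ℕ} : μ.hole i ≤ 0 ↔ (i, i) ∈ μ := by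
  rw [mem_iff_lt_colLen, hole]
  omega

theorem exists_durfee (μ : YoungDiagram) : ∃ d, ∀ i, (i, i) ∈ μ ↔ i < d := by
  classical
  have hex : ∃ i, (i, i) ∉ μ := ⟨μ.rowLen 0, fun h => by
    have := mem_iff_lt_rowLen.1 h
    have := μ.rowLen_le (μ.rowLen 0)
    omega⟩
  refine ⟨Nat.find hex, fun i => ⟨fun hi => ?_, fun hi => not_not.1 (Nat.find_min hex hi)⟩⟩
  by_contra hlt
  exact Nat.find_spec hex (μ.up_left_mem (not_lt.1 hlt) (not_lt.1 hlt) hi)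

theorem IsThreshold.hole_eq {μ : YoungDiagram} (h : μ.IsThreshold) {i : ℕ} (hi : (i, i) ∈ μ) :
    μ.hole i = -μ.bead i := by
  have := h i hi
  simp only [hole, bead]
  omega

/-- A partition is threshold if the involution `m ↦ -m` exchanges positive beads and nonpositive
holes. -/
theorem isThreshold_of_forall {μ : YoungDiagram}
    (h : ∀ m : ℤ, (∃ i, (i, i) ∈ μ ∧ μ.bead i = m) ↔ ∃ j, (j, j) ∈ μ ∧ μ.hole j = -m) :
    μ.IsThreshold := by
  obtain ⟨d, hd⟩ := μ.exists_durfee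
  have h1 : Set.range (fun i : Fin d => -μ.bead i) = Set.range fun i : Fin d => μ.hole i := by
    ext m
    constructor
    · rintro ⟨i, rfl⟩
      obtain ⟨j, hj, hjm⟩ := (h (μ.bead i)).1 ⟨i, (hd i).2 i.2, rfl⟩
      exact ⟨⟨j, (hd j).1 hj⟩, hjm⟩
    · rintro ⟨i, rfl⟩
      obtain ⟨j, hj, hjm⟩ := (h (-μ.hole i)).2 ⟨i, (hd i).2 i.2, by simp⟩
      exact ⟨⟨j, (hd j).1 hj⟩, by simp [hjm]⟩
  have h2 := (StrictMono.range_inj (f := fun i : Fin d => -μ.bead i)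
    (fun i j hij => neg_lt_neg (μ.bead_strictAnti hij))
    (fun i j hij => μ.hole_strictMono hij)).1 h1
  intro i hi
  have := congrFun h2 ⟨i, (hd i).1 hi⟩
  simp only [bead, hole] at this
  omega

theorem card_lower_bound (μ : YoungDiagram) (h : (0, 0) ∈ μ) :
    μ.rowLen 0 + μ.colLen 0 ≤ μ.card + 1 := by
  have hc := mem_iff_lt_colLen.1 h
  obtain ⟨c, hc⟩ : ∃ c, μ.colLen 0 = c + 1 := ⟨μ.colLen 0 - 1, by omega⟩
  rw [card_eq_sum_rowLen μ le_rfl, hc, sum_range_succ']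
  have : ∑ _i ∈ range c, 1 ≤ ∑ i ∈ range c, μ.rowLen (i + 1) := by
    refine sum_le_sum fun i hi => ?_
    have := lt_rowLen_iff_lt_colLen (μ := μ) (i := i + 1) (j := 0)
    have := mem_range.1 hi
    omega
  simp at this
  omega

/-- The hook of the cell (0, 0) has at most 2h cells, and the threshold condition makes its leg
exceed its arm by one. Hence h + 1 variables suffice for all threshold partitions of 2h. -/
theorem IsThreshold.bounds {μ : YoungDiagram} (hμ : μ.IsThreshold) {h : ℕ}
    (hc : μ.card = 2 * h) : μ.rowLen 0 ≤ h ∧ μ.colLen 0 ≤ h + 1 := by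
  by_cases h0 : (0, 0) ∈ μ
  · have := hμ 0 h0
    have := μ.card_lower_bound h0
    omega
  · have h1 := h0
    rw [mem_iff_lt_rowLen] at h0
    rw [mem_iff_lt_colLen] at h1
    omega

/-- The set of positions of positive beads. -/
def positiveBeads (N : ℕ) (μ : YoungDiagram) : Finset (Fin (N + 1)) :=
  univ.filter fun y => y ≠ 0 ∧ ∃ i : Fin (N + 1), μ.bead i = (y : ℕ)

theorem zero_notMem_positiveBeads (N : ℕ) (μ : YoungDiagram) : 0 ∉ positiveBeads N μ := by
  simp [positiveBeads]

/-- A bead at m has exponent N + m. For threshold μ a positive bead at y forces a hole at -y, so the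
nonpositive beads have exponents N - y with y not flipped; equal cardinality gives the rest. -/
theorem IsThreshold.image_betaNumbers {μ : YoungDiagram} (hμ : μ.IsThreshold) {N : ℕ}
    (hr : μ.rowLen 0 ≤ N) :
    univ.image (betaNumbers (N + 1) μ) = univ.image (flipExponents N (positiveBeads N μ)) := by
  refine eq_of_subset_of_card_le ?_ ?_
  · intro b hb
    obtain ⟨i, -, rfl⟩ := mem_image.1 hb
    have hi := bead_eq_betaNumbers μ i
    have hi2 := i.2
    have hri := μ.rowLen_le i
    rw [mem_image]
    rcases lt_trichotomy (μ.bead i) 0 with h | h | h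
    · have hy : (-μ.bead i).toNat < N + 1 := by simp only [bead] at *; omega
      refine ⟨⟨_, hy⟩, mem_univ _, ?_⟩
      rw [flipExponents, if_neg]
      · simp only
        omega
      · intro hmem
        obtain ⟨j, hj⟩ := (mem_filter.1 hmem).2.2
        simp only [Int.toNat_of_nonneg (show 0 ≤ -μ.bead i by omega)] at hj
        have hjj := bead_pos_iff.1 (show 0 < μ.bead j by omega)
        have := hμ.hole_eq hjj
        exact μ.bead_ne_hole i j (by omega)
    · refine ⟨0, mem_univ _, ?_⟩
      rw [flipExponents, if_neg (zero_notMem_positiveBeads N μ)]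
      simp only [Fin.val_zero]
      omega
    · have hy : (μ.bead i).toNat < N + 1 := by simp only [bead] at *; omega
      refine ⟨⟨_, hy⟩, mem_univ _, ?_⟩
      rw [flipExponents, if_pos]
      · simp only
        omega
      · simp only [positiveBeads, mem_filter, mem_univ, true_and]
        refine ⟨fun h0 => ?_, i, by omega⟩
        have := congrArg Fin.val h0
        simp only [Fin.val_zero] at this
        omega
  · rw [card_image_of_injective _ (betaNumbers_strictAnti _ μ).injective]
    exact card_image_le

section Flip

variable {N : ℕ} {s : Finset (Fin (N + 1))} {μ : YoungDiagram}

theorem exists_bead_eq_iff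
    (h : univ.image (betaNumbers (N + 1) μ) = univ.image (flipExponents N s))
    (y : Fin (N + 1)) (hy : y ≠ 0) : (∃ i : Fin (N + 1), μ.bead i = (y : ℕ)) ↔ y ∈ s := by
  have hy0 : (y : ℕ) ≠ 0 := fun h0 => hy (Fin.ext h0)
  have hyN := y.2
  constructor
  · rintro ⟨i, hi⟩
    have h1 : betaNumbers (N + 1) μ i ∈ univ.image (flipExponents N s) :=
      h ▸ mem_image_of_mem _ (mem_univ i)
    obtain ⟨z, -, hz⟩ := mem_image.1 h1
    rw [bead_eq_betaNumbers, ← hz, flipExponents] at hi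
    split_ifs at hi with hzs
    · rwa [show y = z from Fin.ext (by omega)]
    · omega
  · intro hys
    have h1 : flipExponents N s y ∈ univ.image (betaNumbers (N + 1) μ) :=
      h ▸ mem_image_of_mem _ (mem_univ y)
    obtain ⟨i, -, hi⟩ := mem_image.1 h1
    refine ⟨i, ?_⟩
    rw [bead_eq_betaNumbers, hi, flipExponents, if_pos hys]
    omega

theorem exists_bead_eq_neg_iff (hs : 0 ∉ s)
    (h : univ.image (betaNumbers (N + 1) μ) = univ.image (flipExponents N s))
    (y : Fin (N + 1)) : (∃ i : Fin (N + 1), μ.bead i = -(y : ℕ)) ↔ y ∉ s := by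
  have hyN := y.2
  have h0 : ∀ c ∈ s, (c : ℕ) ≠ 0 := fun c hc h => hs (by
    rwa [show (0 : Fin (N + 1)) = c from Fin.ext h.symm])
  constructor
  · rintro ⟨i, hi⟩ hys
    have h1 : betaNumbers (N + 1) μ i ∈ univ.image (flipExponents N s) :=
      h ▸ mem_image_of_mem _ (mem_univ i)
    obtain ⟨z, -, hz⟩ := mem_image.1 h1
    have hzN := z.2
    have := h0 y hys
    rw [bead_eq_betaNumbers, ← hz, flipExponents] at hi
    split_ifs at hi with hzs
    · omega
    · exact hzs (by rwa [show z = y from Fin.ext (by omega)])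
  · intro hys
    have h1 : flipExponents N s y ∈ univ.image (betaNumbers (N + 1) μ) :=
      h ▸ mem_image_of_mem _ (mem_univ y)
    obtain ⟨i, -, hi⟩ := mem_image.1 h1
    refine ⟨i, ?_⟩
    rw [bead_eq_betaNumbers, hi, flipExponents, if_neg hys]
    omega

theorem positiveBeads_eq (hs : 0 ∉ s)
    (h : univ.image (betaNumbers (N + 1) μ) = univ.image (flipExponents N s)) :
    positiveBeads N μ = s := by
  ext y
  simp only [positiveBeads, mem_filter, mem_univ, true_and]
  constructor
  · rintro ⟨hy, hi⟩
    exact (exists_bead_eq_iff h y hy).1 hi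
  · intro hy
    have hy0 : y ≠ 0 := fun h0 => hs (h0 ▸ hy)
    exact ⟨hy0, (exists_bead_eq_iff h y hy0).2 hy⟩

theorem card_eq_of_image_betaNumbers (hc : μ.colLen 0 ≤ N + 1) (hs : 0 ∉ s)
    (h : univ.image (betaNumbers (N + 1) μ) = univ.image (flipExponents N s)) :
    μ.card = 2 * ∑ y ∈ s, (y : ℕ) := by
  have h1 : ∑ i, betaNumbers (N + 1) μ i = ∑ y, flipExponents N s y := by
    rw [← sum_image (f := fun b => b) (betaNumbers_strictAnti _ μ).injective.injOn, h,
      sum_image (flipExponents_injective hs).injOn]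
  have h2 : ∀ y : Fin (N + 1), flipExponents N s y =
      (N - (y : ℕ)) + if y ∈ s then 2 * (y : ℕ) else 0 := fun y => by
    have := y.2
    rw [flipExponents]
    split_ifs <;> omega
  simp only [h2, betaNumbers, sum_add_distrib, sum_ite_mem, univ_inter, ← mul_sum,
    ← card_eq_sum_fin_rowLen μ hc, Nat.add_sub_cancel] at h1
  omega

/-- The exponents contain exactly one of N + y and N - y for each y > 0, and N itself. So m ↦ -m
exchanges positive beads with nonpositive holes; all positions below -N carry beads of empty rows.
-/
theorem isThreshold_of_image_betaNumbers (hc : μ.colLen 0 ≤ N + 1) (hs : 0 ∉ s)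
    (h : univ.image (betaNumbers (N + 1) μ) = univ.image (flipExponents N s)) :
    μ.IsThreshold := by
  have hbig : ∀ i : ℕ, -(N : ℤ) ≤ μ.bead i → i < N + 1 := fun i hi => by
    by_contra hlt
    have := rowLen_eq_zero (hc.trans (not_lt.1 hlt))
    simp only [bead] at hi
    omega
  have hfar : ∀ m : ℤ, m < -N → ∃ i, μ.bead i = m := fun m hm => by
    refine ⟨(-m).toNat, ?_⟩
    have := rowLen_eq_zero (μ := μ) (i := (-m).toNat) (by omega)
    simp only [bead]
    omega
  have h0 : ∃ i, μ.bead i = 0 := by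
    obtain ⟨i, hi⟩ := (exists_bead_eq_neg_iff hs h 0).2 hs
    exact ⟨i, by simpa using hi⟩
  have hup : ∀ i, μ.bead i ≤ N := fun i => by
    by_cases hi : i < N + 1
    · have h1 : betaNumbers (N + 1) μ ⟨i, hi⟩ ∈ univ.image (flipExponents N s) :=
        h ▸ mem_image_of_mem _ (mem_univ _)
      obtain ⟨z, -, hz⟩ := mem_image.1 h1
      have h2 := bead_eq_betaNumbers μ ⟨i, hi⟩
      have := z.2
      rw [← hz, flipExponents] at h2
      simp only at h2
      split_ifs at h2 <;> omega
    · have := rowLen_eq_zero (hc.trans (not_lt.1 hi))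
      simp only [bead]
      omega
  refine isThreshold_of_forall fun m => ⟨?_, ?_⟩
  · rintro ⟨i, hi, rfl⟩
    have hpos := bead_pos_iff.2 hi
    have hle := hup i
    have hy : (μ.bead i).toNat < N + 1 := by omega
    have hmem := (exists_bead_eq_iff h ⟨_, hy⟩ (fun h0 => by
      have := congrArg Fin.val h0
      simp only [Fin.val_zero] at this
      omega)).1 ⟨⟨i, hbig i (by omega)⟩, by simp only; omega⟩
    rcases μ.exists_bead_or_exists_hole (-μ.bead i) with ⟨k, hk⟩ | ⟨j, hj⟩
    · exact absurd hmem ((exists_bead_eq_neg_iff hs h ⟨_, hy⟩).1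
        ⟨⟨k, hbig k (by omega)⟩, by simp only; omega⟩)
    · exact ⟨j, hole_nonpos_iff.1 (by omega), hj⟩
  · rintro ⟨j, hj, hjm⟩
    have hneg := hole_nonpos_iff.2 hj
    have hm0 : m ≠ 0 := by
      rintro rfl
      obtain ⟨i, hi⟩ := h0
      exact μ.bead_ne_hole i j (by omega)
    have hmN : m ≤ N := by
      by_contra hlt
      obtain ⟨i, hi⟩ := hfar (-m) (by omega)
      exact μ.bead_ne_hole i j (by omega)
    have hy : m.toNat < N + 1 := by omega
    have hmem : (⟨_, hy⟩ : Fin (N + 1)) ∈ s := by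
      by_contra hmem
      obtain ⟨i, hi⟩ := (exists_bead_eq_neg_iff hs h ⟨_, hy⟩).2 hmem
      simp only at hi
      exact μ.bead_ne_hole i j (by omega)
    obtain ⟨i, hi⟩ := (exists_bead_eq_iff h ⟨_, hy⟩ (fun h0 => by
      have := congrArg Fin.val h0
      simp only [Fin.val_zero] at this
      omega)).2 hmem
    simp only at hi
    exact ⟨i, bead_pos_iff.1 (by omega), by omega⟩

end Flip

end YoungDiagram

namespace SymFun

open Finset Matrix YoungDiagram

theorem mem_thresholdPartitions {n : ℕ} {μ : YoungDiagram} :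
    μ ∈ thresholdPartitions n ↔ μ.card = n ∧ μ.IsThreshold := by
  simp [thresholdPartitions, mem_partitionsOf]

/-- Littlewood's expansion of `e_h[e_2]`. -/
theorem plethysmHom_elem (h : ℕ) :
    plethysmHom (elem 2) (elem h) = ∑ ν ∈ thresholdPartitions (2 * h), schur ℚ ν := by
  refine eq_of_evalAt_eq (h + 1) fun n hn => ?_
  obtain ⟨N, rfl⟩ : ∃ N, n = N + 1 := ⟨n - 1, by omega⟩
  have hT : ∀ ν ∈ thresholdPartitions (2 * h), ν.IsThreshold ∧ ν.rowLen 0 ≤ N ∧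
      ν.colLen 0 ≤ N + 1 := fun ν hν => by
    obtain ⟨h1, h2⟩ := mem_thresholdPartitions.1 hν
    have := h2.bounds h1
    exact ⟨h2, by omega, by omega⟩
  apply mul_right_cancel₀ (alternant_X_ne_zero (N + 1))
  rw [map_sum, sum_mul]
  refine (evalAt_plethysmHom_elem MvPolynomial.X (fun k => MvPolynomial.X_ne_zero k) h).trans ?_
  symm
  have himg : ∀ {s : Finset (Fin (N + 1))} {μ : YoungDiagram} {σ : Equiv.Perm (Fin (N + 1))},
      flipExponents N s = betaNumbers (N + 1) μ ∘ σ →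
        univ.image (betaNumbers (N + 1) μ) = univ.image (flipExponents N s) := by
    intro s μ σ hσ
    rw [hσ, ← image_image, image_univ_equiv]
  -- Threshold partitions of 2h correspond to sets s of positive positions with sum h, since
  -- flipping y adds 2y to the sum of the exponents.
  refine sum_of_injOn (positiveBeads N) ?_ ?_ ?_ ?_
  · intro ν hν ρ hρ hνρ
    obtain ⟨h1, h2, h3⟩ := hT ν hν
    obtain ⟨h4, h5, h6⟩ := hT ρ hρ
    refine eq_of_image_betaNumbers_eq h3 h6 ?_
    rw [h1.image_betaNumbers h2, h4.image_betaNumbers h5, hνρ]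
  · intro ν hν
    obtain ⟨h1, h2, h3⟩ := hT ν hν
    have h0 := zero_notMem_positiveBeads N ν
    have hc := card_eq_of_image_betaNumbers h3 h0 (h1.image_betaNumbers h2)
    rw [(mem_thresholdPartitions.1 hν).1] at hc
    rw [mem_coe, mem_filter]
    exact ⟨mem_univ _, h0, by omega⟩
  · intro s hs hns
    obtain ⟨-, h0, hsum⟩ := mem_filter.1 hs
    obtain ⟨μ, hμ, σ, hσ⟩ := exists_betaNumbers_comp _ (flipExponents_injective h0)
    refine absurd ⟨μ, ?_, positiveBeads_eq h0 (himg hσ)⟩ hns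
    rw [mem_coe, mem_thresholdPartitions, card_eq_of_image_betaNumbers hμ h0 (himg hσ), hsum]
    exact ⟨rfl, isThreshold_of_image_betaNumbers hμ h0 (himg hσ)⟩
  · intro ν hν
    obtain ⟨h1, h2, h3⟩ := hT ν hν
    have h0 := zero_notMem_positiveBeads N ν
    obtain ⟨μ, hμ, σ, hσ⟩ := exists_betaNumbers_comp _ (flipExponents_injective h0)
    obtain rfl : μ = ν := eq_of_image_betaNumbers_eq hμ h3
      ((himg hσ).trans (h1.image_betaNumbers h2).symm)
    have hc := card_eq_of_image_betaNumbers h3 h0 (himg hσ)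
    rw [(mem_thresholdPartitions.1 hν).1] at hc
    rw [hσ, alternant_comp_perm, sign_eq_of_flipExponents_eq hσ,
      ← alternant_betaNumbers _ _ h3, show ∑ y ∈ positiveBeads N μ, (y : ℕ) = h by omega]
    push_cast
    rw [← mul_assoc, ← mul_pow]
    simp

end SymFun

/-! ### Removing a vertical strip of two cells -/

namespace YoungDiagram

open Finset

/-- The partition `lam` arises from `μ` by removing the last cells of the rows `r < s`. -/
structure RemovesRows (lam μ : YoungDiagram) (r s : ℕ) : Prop where
  lt : r < s
  left : μ.rowLen r = lam.rowLen r + 1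
  right : μ.rowLen s = lam.rowLen s + 1
  other : ∀ i, i ≠ r → i ≠ s → μ.rowLen i = lam.rowLen i

namespace RemovesRows

variable {lam μ : YoungDiagram} {r s : ℕ}

theorem rowLen_eq (h : RemovesRows lam μ r s) (i : ℕ) :
    μ.rowLen i = lam.rowLen i + if i = r ∨ i = s then 1 else 0 := by
  split_ifs with hi
  · rcases hi with rfl | rfl
    · exact h.left
    · exact h.right
  · rw [not_or] at hi
    exact h.other i hi.1 hi.2

theorem isVerticalStrip (h : RemovesRows lam μ r s) : IsVerticalStrip lam μ := fun i => by
  rw [h.rowLen_eq i]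
  split_ifs <;> omega

theorem card_eq (h : RemovesRows lam μ r s) : μ.card = lam.card + 2 := by
  have hlt := h.lt
  set n := μ.colLen 0 + lam.colLen 0 + s + 1
  rw [μ.card_eq_sum_rowLen (n := n) (by omega), lam.card_eq_sum_rowLen (n := n) (by omega),
    sum_congr rfl fun i _ => h.rowLen_eq i, sum_add_distrib, ← card_filter]
  have : (range n).filter (fun i => i = r ∨ i = s) = {r, s} := by
    ext i
    simp only [mem_filter, mem_range, mem_insert, mem_singleton]
    omega
  rw [this, card_pair hlt.ne]

theorem eq_of_rows {ρ : YoungDiagram} (h : RemovesRows lam μ r s) (h' : RemovesRows ρ μ r s) :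
    lam = ρ :=
  ext_rowLen fun i => by
    have h1 := h.rowLen_eq i
    have h2 := h'.rowLen_eq i
    omega

theorem colLen_other (h : RemovesRows lam μ r s) {j : ℕ} (h1 : j ≠ lam.rowLen r)
    (h2 : j ≠ lam.rowLen s) : μ.colLen j = lam.colLen j := by
  have key : ∀ i, j < μ.rowLen i ↔ j < lam.rowLen i := fun i => by
    by_cases hr : i = r
    · subst hr
      have := h.left
      omega
    · by_cases hs : i = s
      · subst hs
        have := h.right
        omega
      · rw [h.other i hr hs]
  have h3 := lt_rowLen_iff_lt_colLen (μ := μ) (i := lam.colLen j) (j := j)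
  have h4 := lt_rowLen_iff_lt_colLen (μ := lam) (i := lam.colLen j) (j := j)
  have h5 := lt_rowLen_iff_lt_colLen (μ := μ) (i := μ.colLen j) (j := j)
  have h6 := lt_rowLen_iff_lt_colLen (μ := lam) (i := μ.colLen j) (j := j)
  have := key (lam.colLen j)
  have := key (μ.colLen j)
  omega

theorem rowLen_le (h : RemovesRows lam μ r s) : lam.rowLen s ≤ lam.rowLen r :=
  lam.rowLen_anti r s h.lt.le

theorem colLen_left (h : RemovesRows lam μ r s) : lam.colLen (lam.rowLen r) = r := by
  have hlt := h.lt
  have h1 := lt_rowLen_iff_lt_colLen (μ := lam) (i := r) (j := lam.rowLen r)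
  rcases Nat.eq_zero_or_pos r with rfl | hpos
  · omega
  · have h2 := lt_rowLen_iff_lt_colLen (μ := lam) (i := r - 1) (j := lam.rowLen r)
    have h3 := h.other (r - 1) (by omega) (by omega)
    have h4 := μ.rowLen_anti (r - 1) r (by omega)
    have := h.left
    omega

theorem colLen_right (h : RemovesRows lam μ r s) : μ.colLen (lam.rowLen s) = s + 1 := by
  have hlt := h.lt
  have h1 := lt_rowLen_iff_lt_colLen (μ := μ) (i := s) (j := lam.rowLen s)
  have h2 := lt_rowLen_iff_lt_colLen (μ := μ) (i := s + 1) (j := lam.rowLen s)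
  have h3 := h.other (s + 1) (by omega) (by omega)
  have h4 := lam.rowLen_anti s (s + 1) (by omega)
  have := h.right
  omega

/-- The inequality says that the two removed cells lie in different columns; otherwise column
`lam.rowLen r` loses both of them. -/
theorem colLen_left_of_ne (h : RemovesRows lam μ r s) (hne : lam.rowLen s ≠ lam.rowLen r) :
    μ.colLen (lam.rowLen r) = r + 1 := by
  have hlt := h.lt
  have hle := h.rowLen_le
  have h1 := lt_rowLen_iff_lt_colLen (μ := μ) (i := r) (j := lam.rowLen r)
  have h2 := lt_rowLen_iff_lt_colLen (μ := μ) (i := r + 1) (j := lam.rowLen r)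
  have h4 := lam.rowLen_anti r (r + 1) (by omega)
  have h5 := h.left
  by_cases hs : r + 1 = s
  · rw [hs] at h2
    have := h.right
    omega
  · have h3 := h.other (r + 1) (by omega) hs
    omega

theorem colLen_right_of_ne (h : RemovesRows lam μ r s) (hne : lam.rowLen s ≠ lam.rowLen r) :
    lam.colLen (lam.rowLen s) = s := by
  have hlt := h.lt
  have hle := h.rowLen_le
  have h1 := lt_rowLen_iff_lt_colLen (μ := lam) (i := s) (j := lam.rowLen s)
  have h2 := lt_rowLen_iff_lt_colLen (μ := lam) (i := s - 1) (j := lam.rowLen s)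
  have h4 := μ.rowLen_anti (s - 1) s (by omega)
  have h5 := h.right
  by_cases hs : r = s - 1
  · rw [← hs] at h2
    omega
  · have h3 := h.other (s - 1) (by omega) (by omega)
    omega

theorem succ_eq_of_eq (h : RemovesRows lam μ r s) (heq : lam.rowLen s = lam.rowLen r) :
    s = r + 1 := by
  have hlt := h.lt
  by_contra hs
  have h1 := h.other (r + 1) (by omega) (by omega)
  have h2 := μ.rowLen_anti (r + 1) s (by omega)
  have h3 := lam.rowLen_anti r (r + 1) (by omega)
  have := h.right
  omega

end RemovesRows

theorem exists_removesRows {lam μ : YoungDiagram} (h : IsVerticalStrip lam μ)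
    (hc : μ.card = lam.card + 2) : ∃ r s, RemovesRows lam μ r s := by
  have hrow : ∀ i, μ.rowLen i = lam.rowLen i + if μ.rowLen i = lam.rowLen i + 1 then 1 else 0 :=
    fun i => by
      have := h i
      split_ifs <;> omega
  set n := μ.colLen 0 + lam.colLen 0
  rw [μ.card_eq_sum_rowLen (n := n) (by omega), lam.card_eq_sum_rowLen (n := n) (by omega),
    sum_congr rfl fun i _ => hrow i, sum_add_distrib, ← card_filter] at hc
  obtain ⟨a, b, hab, hset⟩ := card_eq_two.1 (Nat.add_left_cancel hc)
  have hmem : ∀ i, μ.rowLen i = lam.rowLen i + 1 ↔ i = a ∨ i = b := fun i => by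
    have h1 := Finset.ext_iff.1 hset i
    simp only [mem_filter, mem_range, mem_insert, mem_singleton] at h1
    rw [← h1]
    refine ⟨fun h2 => ⟨?_, h2⟩, fun h2 => h2.2⟩
    by_contra hi
    have := rowLen_eq_zero (μ := μ) (i := i) (by omega)
    omega
  have hother : ∀ i, i ≠ a → i ≠ b → μ.rowLen i = lam.rowLen i := fun i h1 h2 => by
    have h3 := hrow i
    rwa [if_neg (fun h4 => ((hmem i).1 h4).elim h1 h2), add_zero] at h3
  rcases lt_or_gt_of_ne hab with hlt | hlt
  · exact ⟨a, b, hlt, (hmem a).2 (Or.inl rfl), (hmem b).2 (Or.inr rfl), hother⟩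
  · exact ⟨b, a, hlt, (hmem b).2 (Or.inr rfl), (hmem a).2 (Or.inl rfl),
      fun i h1 h2 => hother i h2 h1⟩

theorem exists_removesRows_of_rowLen_lt {μ : YoungDiagram} {r s : ℕ} (hrs : r < s)
    (h1 : r + 1 = s ∨ μ.rowLen (r + 1) < μ.rowLen r) (h2 : μ.rowLen (s + 1) < μ.rowLen s) :
    ∃ lam, RemovesRows lam μ r s := by
  let f : ℕ → ℕ := fun i => μ.rowLen i - if i = r ∨ i = s then 1 else 0
  have hrs' := μ.rowLen_anti r s hrs.le
  have hf : Antitone f := by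
    refine antitone_nat_of_succ_le fun i => ?_
    have h3 := μ.rowLen_anti i (i + 1) (by omega)
    simp only [f]
    by_cases hr : i = r
    · subst hr
      by_cases hs : i + 1 = s
      · rw [if_pos (Or.inr hs), if_pos (Or.inl rfl)]
        omega
      · rw [if_neg (by omega), if_pos (Or.inl rfl)]
        omega
    · by_cases hs : i = s
      · subst hs
        rw [if_neg (by omega), if_pos (Or.inr rfl)]
        omega
      · rw [if_neg (show ¬ (i = r ∨ i = s) by omega)]
        omega
  have hfn : f (μ.colLen 0) = 0 := by
    simp only [f]
    rw [rowLen_eq_zero le_rfl, Nat.zero_sub]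
  have hrl := rowLen_ofAntitone hf hfn
  refine ⟨ofAntitone f (μ.colLen 0) hf, ⟨hrs, ?_, ?_, fun i hr hs => ?_⟩⟩
  · rw [hrl]
    simp only [f, true_or, if_true]
    omega
  · rw [hrl]
    simp only [f, or_true, if_true]
    omega
  · rw [hrl]
    simp only [f]
    rw [if_neg (by omega), Nat.sub_zero]

/-- The deviation of `μ` from the threshold condition. -/
def defect (μ : YoungDiagram) (k : ℕ) : ℤ := μ.colLen k - μ.rowLen k - 1

/-- The deviation of `μ` from the threshold condition, if removing the last cells of the rows
`r < s` leads to a threshold partition. -/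
def rowsDefect (μ : YoungDiagram) (r s k : ℕ) : ℤ :=
  (if k + 1 = μ.rowLen r ∧ k < r then 1 else 0) + (if k + 1 = μ.rowLen s ∧ k < s then 1 else 0) -
    (if k = r ∧ r < μ.rowLen r then 1 else 0) - (if k = s ∧ s < μ.rowLen s then 1 else 0)

/-- A removed cell below the diagonal adds 1 to the defect of its column; one on or right of the
diagonal subtracts 1 from the defect of its row. If the diagonal cell (k, k) itself is removed,
`lam` imposes no condition at k, and the equation at k holds by itself. -/
theorem RemovesRows.isThreshold_iff {lam μ : YoungDiagram} {r s : ℕ} (h : RemovesRows lam μ r s) :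
    lam.IsThreshold ↔ ∀ k, (k, k) ∈ μ → μ.defect k = μ.rowsDefect r s k := by
  have key : ∀ k, (k, k) ∈ μ → (((k, k) ∈ lam → lam.colLen k = lam.rowLen k + 1) ↔
      μ.defect k = μ.rowsDefect r s k) := by
    intro k hk
    have hlt := h.lt
    have hl := h.left
    have hr := h.right
    have hle := h.rowLen_le
    have hcl := h.colLen_left
    have hcr := h.colLen_right
    have hk1 := mem_iff_lt_rowLen.1 hk
    have hk2 := mem_iff_lt_colLen.1 hk
    have hk3 := lt_rowLen_iff_lt_colLen (μ := lam) (i := k) (j := k)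
    rw [mem_iff_lt_rowLen, defect, rowsDefect]
    have hrow : k = r ∨ k = s ∨ k ≠ r ∧ k ≠ s ∧ μ.rowLen k = lam.rowLen k := by
      by_cases h1 : k = r
      · exact Or.inl h1
      · by_cases h2 : k = s
        · exact Or.inr (Or.inl h2)
        · exact Or.inr (Or.inr ⟨h1, h2, h.other k h1 h2⟩)
    have hcol : (k = lam.rowLen r ∧ μ.colLen k = s + 1 ∧ lam.colLen k = r ∧
          lam.rowLen s = lam.rowLen r ∧ s = r + 1) ∨
        (k = lam.rowLen r ∧ μ.colLen k = r + 1 ∧ lam.colLen k = r ∧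
          lam.rowLen s < lam.rowLen r) ∨
        (k = lam.rowLen s ∧ μ.colLen k = s + 1 ∧ lam.colLen k = s ∧
          lam.rowLen s < lam.rowLen r) ∨
        (k ≠ lam.rowLen r ∧ k ≠ lam.rowLen s ∧ μ.colLen k = lam.colLen k) := by
      by_cases h1 : k = lam.rowLen r
      · by_cases heq : lam.rowLen s = lam.rowLen r
        · left
          refine ⟨h1, ?_, ?_, heq, h.succ_eq_of_eq heq⟩
          · rw [h1, ← heq, hcr]
          · rw [h1, hcl]
        · right; left
          refine ⟨h1, ?_, ?_, lt_of_le_of_ne hle heq⟩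
          · rw [h1, h.colLen_left_of_ne heq]
          · rw [h1, hcl]
      · by_cases h2 : k = lam.rowLen s
        · right; right; left
          have heq : lam.rowLen s ≠ lam.rowLen r := fun heq => h1 (h2.trans heq)
          refine ⟨h2, ?_, ?_, lt_of_le_of_ne hle heq⟩
          · rw [h2, hcr]
          · rw [h2, h.colLen_right_of_ne heq]
        · exact Or.inr (Or.inr (Or.inr ⟨h1, h2, h.colLen_other h1 h2⟩))
    clear h hcl hcr hk
    rw [hl, hr]
    by_cases hkl : k < lam.rowLen k
    · simp only [hkl, true_imp_iff]
      rcases hrow with hrow | hrow | hrow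
      · subst hrow
        rcases hcol with hcol | hcol | hcol | hcol <;> split_ifs <;> omega
      · subst hrow
        rcases hcol with hcol | hcol | hcol | hcol <;> split_ifs <;> omega
      · rcases hcol with hcol | hcol | hcol | hcol <;> split_ifs <;> omega
    · simp only [hkl, false_imp_iff, true_iff]
      rcases hrow with hrow | hrow | hrow
      · subst hrow
        rcases hcol with hcol | hcol | hcol | hcol <;> split_ifs <;> omega
      · subst hrow
        rcases hcol with hcol | hcol | hcol | hcol <;> split_ifs <;> omega
      · rcases hcol with hcol | hcol | hcol | hcol <;> split_ifs <;> omega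
  refine ⟨fun hT k hk => (key k hk).1 (hT k), fun hD k hk => ?_⟩
  have hkμ : (k, k) ∈ μ := by
    rw [mem_iff_lt_rowLen] at hk ⊢
    have := (h.isVerticalStrip k).1
    omega
  exact (key k hkμ).2 (hD k hkμ) hk

end YoungDiagram

/-! ### The removable strips of non-threshold partitions -/

namespace YoungDiagram

open Finset

theorem isCorner_bottom_iff {μ : YoungDiagram} {i : ℕ} (hi : (i, i) ∈ μ) :
    μ.IsCorner (μ.colLen i - 1, i) ↔ μ.rowLen (μ.colLen i - 1) = i + 1 := by
  have h0 := mem_iff_lt_colLen.1 hi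
  have h1 := lt_rowLen_iff_lt_colLen (μ := μ) (i := μ.colLen i - 1) (j := i)
  have h2 := lt_rowLen_iff_lt_colLen (μ := μ) (i := μ.colLen i - 1 + 1) (j := i)
  simp only [IsCorner, mem_iff_lt_rowLen]
  omega

theorem defect_eq_zero_iff {μ : YoungDiagram} {k : ℕ} :
    μ.defect k = 0 ↔ μ.colLen k = μ.rowLen k + 1 := by
  rw [defect]
  omega

namespace RemovesRows

variable {lam μ : YoungDiagram} {r s : ℕ}

theorem colLen_of_succ_eq_right (h : RemovesRows lam μ r s) {k : ℕ} (hk : k + 1 = μ.rowLen s) :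
    μ.colLen k = s + 1 := by
  rw [← h.colLen_right]
  congr 1
  have := h.right
  omega

theorem colLen_of_succ_eq_left (h : RemovesRows lam μ r s) (hne : μ.rowLen s ≠ μ.rowLen r) {k : ℕ}
    (hk : k + 1 = μ.rowLen r) : μ.colLen k = r + 1 := by
  have h1 := h.left
  have h2 := h.right
  rw [← h.colLen_left_of_ne (by omega)]
  congr 1
  omega

theorem succ_eq_of_rowLen_eq (h : RemovesRows lam μ r s) (heq : μ.rowLen s = μ.rowLen r) :
    s = r + 1 :=
  h.succ_eq_of_eq (by have := h.left; have := h.right; omega)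

/-- The removed rows can be read off from the defects, unless these vanish. -/
theorem row_iff (h : RemovesRows lam μ r s) (hlam : lam.IsThreshold) (hμ : ¬ μ.IsThreshold)
    (i : ℕ) : (i = r ∨ i = s) ↔ ((i, i) ∈ μ ∧ μ.defect i = -1) ∨
      ∃ k, (k, k) ∈ μ ∧ (μ.defect k = 1 ∧ i + 1 = μ.colLen k ∨
        μ.defect k = 2 ∧ (i + 1 = μ.colLen k ∨ i + 2 = μ.colLen k)) := by
  have hF := h.isThreshold_iff.1 hlam
  have hlt := h.lt
  have hle := μ.rowLen_anti r s hlt.le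
  have hs0 := h.right
  -- If the cell of row `s` lies in column `r`, the contributions of the two cells to the defect at
  -- `r` cancel and μ is threshold.
  have hnt : ¬ (r + 1 = μ.rowLen s) := fun hrs => hμ fun k hk => by
    have := hF k hk
    rw [← defect_eq_zero_iff, this, rowsDefect]
    split_ifs <;> omega
  have hcr := fun k => h.colLen_of_succ_eq_right (k := k)
  have hcl := fun hne k => h.colLen_of_succ_eq_left hne (k := k)
  have heq := h.succ_eq_of_rowLen_eq
  constructor
  · rintro (rfl | rfl)
    · by_cases hi : i < μ.rowLen i
      · left
        refine ⟨mem_iff_lt_rowLen.2 hi, ?_⟩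
        rw [hF i (mem_iff_lt_rowLen.2 hi), rowsDefect]
        split_ifs <;> omega
      · right
        by_cases hne : μ.rowLen s = μ.rowLen i
        · have hc := hcr (μ.rowLen s - 1) (by omega)
          have hmem : (μ.rowLen s - 1, μ.rowLen s - 1) ∈ μ := mem_iff_lt_colLen.2 (by omega)
          have hd := hF _ hmem
          refine ⟨_, hmem, Or.inr ⟨?_, ?_⟩⟩
          · rw [hd, rowsDefect]
            split_ifs <;> omega
          · have := heq hne
            omega
        · have hc := hcl hne (μ.rowLen i - 1) (by omega)
          have hmem : (μ.rowLen i - 1, μ.rowLen i - 1) ∈ μ := mem_iff_lt_colLen.2 (by omega)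
          have hd := hF _ hmem
          refine ⟨_, hmem, Or.inl ⟨?_, by omega⟩⟩
          rw [hd, rowsDefect]
          split_ifs <;> omega
    · by_cases hi : i < μ.rowLen i
      · left
        refine ⟨mem_iff_lt_rowLen.2 hi, ?_⟩
        rw [hF i (mem_iff_lt_rowLen.2 hi), rowsDefect]
        split_ifs <;> omega
      · right
        have hc := hcr (μ.rowLen i - 1) (by omega)
        have hmem : (μ.rowLen i - 1, μ.rowLen i - 1) ∈ μ := mem_iff_lt_colLen.2 (by omega)
        have hd := hF _ hmem
        refine ⟨_, hmem, ?_⟩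
        rw [hd, rowsDefect]
        split_ifs <;> omega
  · rintro (⟨hi, hd⟩ | ⟨k, hk, hd⟩)
    · rw [hF i hi, rowsDefect] at hd
      split_ifs at hd <;> omega
    · rw [hF k hk, rowsDefect] at hd
      have h1 := hcr k
      have h2 := fun hne => hcl hne k
      split_ifs at hd <;> omega

/-- Each removed cell gives one small defect: equality of row and column for a cell on or right of
the diagonal, an excess of 2 at a corner for a cell below it. Two cells below the diagonal in one
column add up to the excess of 3. -/
theorem isNearThreshold (h : RemovesRows lam μ r s) (hlam : lam.IsThreshold)
    (hμ : ¬ μ.IsThreshold) : μ.IsNearThreshold := by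
  have hF := h.isThreshold_iff.1 hlam
  have hlt := h.lt
  have hle := μ.rowLen_anti r s hlt.le
  have hs0 := h.right
  have hnt : ¬ (r + 1 = μ.rowLen s) := fun hrs => hμ fun k hk => by
    have := hF k hk
    rw [← defect_eq_zero_iff, this, rowsDefect]
    split_ifs <;> omega
  simp only [rowsDefect, defect] at hF
  by_cases hr : r < μ.rowLen r
  · have hrm : (r, r) ∈ μ := mem_iff_lt_rowLen.2 hr
    by_cases hs : s < μ.rowLen s
    · have hsm : (s, s) ∈ μ := mem_iff_lt_rowLen.2 hs
      refine Or.inl ⟨r, s, hlt.ne, hrm, hsm, Or.inr ?_, Or.inr ?_, fun k hk h1 h2 => ?_⟩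
      · have := hF r hrm
        split_ifs at this <;> omega
      · have := hF s hsm
        split_ifs at this <;> omega
      · have := hF k hk
        split_ifs at this <;> omega
    · obtain ⟨c, hc⟩ : ∃ c, c + 1 = μ.rowLen s := ⟨μ.rowLen s - 1, by omega⟩
      have hcc := h.colLen_of_succ_eq_right hc
      have hcm : (c, c) ∈ μ := mem_iff_lt_colLen.2 (by omega)
      refine Or.inl ⟨r, c, by omega, hrm, hcm, Or.inr ?_, Or.inl ⟨?_, ?_⟩, fun k hk h1 h2 => ?_⟩
      · have := hF r hrm
        split_ifs at this <;> omega
      · have := hF c hcm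
        split_ifs at this <;> omega
      · rw [isCorner_bottom_iff hcm, hcc, Nat.add_sub_cancel, hc]
      · have := hF k hk
        split_ifs at this <;> omega
  · obtain ⟨c, hc⟩ : ∃ c, c + 1 = μ.rowLen s := ⟨μ.rowLen s - 1, by omega⟩
    have hcc := h.colLen_of_succ_eq_right hc
    have hcm : (c, c) ∈ μ := mem_iff_lt_colLen.2 (by omega)
    by_cases hne : μ.rowLen s = μ.rowLen r
    · refine Or.inr ⟨c, hcm, ?_, fun k hk h1 => ?_⟩
      · have := hF c hcm
        split_ifs at this <;> omega
      · have := hF k hk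
        split_ifs at this <;> omega
    · obtain ⟨e, he⟩ : ∃ e, e + 1 = μ.rowLen r := ⟨μ.rowLen r - 1, by omega⟩
      have hee := h.colLen_of_succ_eq_left hne he
      have hem : (e, e) ∈ μ := mem_iff_lt_colLen.2 (by omega)
      refine Or.inl ⟨e, c, by omega, hem, hcm, Or.inl ⟨?_, ?_⟩, Or.inl ⟨?_, ?_⟩,
        fun k hk h1 h2 => ?_⟩
      · have := hF e hem
        split_ifs at this <;> omega
      · rw [isCorner_bottom_iff hem, hee, Nat.add_sub_cancel, he]
      · have := hF c hcm
        split_ifs at this <;> omega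
      · rw [isCorner_bottom_iff hcm, hcc, Nat.add_sub_cancel, hc]
      · have := hF k hk
        split_ifs at this <;> omega

theorem unique {ρ : YoungDiagram} {r' s' : ℕ} (h : RemovesRows lam μ r s)
    (h' : RemovesRows ρ μ r' s') (hlam : lam.IsThreshold) (hρ : ρ.IsThreshold)
    (hμ : ¬ μ.IsThreshold) : lam = ρ := by
  have key : ∀ i, (i = r ∨ i = s) ↔ (i = r' ∨ i = s') := fun i =>
    (h.row_iff hlam hμ i).trans (h'.row_iff hρ hμ i).symm
  have h1 := key r
  have h2 := key s
  have h3 := h.lt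
  have h4 := h'.lt
  obtain ⟨rfl, rfl⟩ : r = r' ∧ s = s' := by omega
  exact h.eq_of_rows h'

end RemovesRows

section Existence

variable {μ : YoungDiagram}

theorem exists_of_rowsDefect {r s : ℕ} (hrs : r < s)
    (h1 : r + 1 = s ∨ μ.rowLen (r + 1) < μ.rowLen r) (h2 : μ.rowLen (s + 1) < μ.rowLen s)
    (hF : ∀ k, (k, k) ∈ μ → μ.defect k = μ.rowsDefect r s k) :
    ∃ lam, RemovesRows lam μ r s ∧ lam.IsThreshold := by
  obtain ⟨lam, h⟩ := exists_removesRows_of_rowLen_lt hrs h1 h2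
  exact ⟨lam, h, h.isThreshold_iff.2 hF⟩

/-- If a row of nonpositive relative length cannot be shortened, then the next row has the same
property. -/
theorem rowLen_succ_lt_or {i : ℕ} (hi : (i, i) ∈ μ) (hd : μ.colLen i = μ.rowLen i) :
    μ.rowLen (i + 1) < μ.rowLen i ∨
      (i + 1, i + 1) ∈ μ ∧ μ.colLen (i + 1) ≤ μ.rowLen (i + 1) := by
  have h1 := mem_iff_lt_rowLen.1 hi
  have h2 := lt_rowLen_iff_lt_colLen (μ := μ) (i := i + 1) (j := i)
  have h3 := μ.rowLen_anti i (i + 1) (by omega)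
  have h4 := μ.colLen_anti i (i + 1) (by omega)
  rw [mem_iff_lt_rowLen]
  omega

/-- The cells to remove are the ends of rows i and j. If row i cannot be shortened alone, the next
diagonal index is also deficient, hence it is j. -/
theorem exists_of_two_neg {i j : ℕ} (hij : i < j) (hi : (i, i) ∈ μ) (hj : (j, j) ∈ μ)
    (hid : μ.colLen i = μ.rowLen i) (hjd : μ.colLen j = μ.rowLen j)
    (hk : ∀ k, (k, k) ∈ μ → k ≠ i → k ≠ j → μ.colLen k = μ.rowLen k + 1) :
    ∃ r s lam, RemovesRows lam μ r s ∧ lam.IsThreshold := by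
  have hi' := mem_iff_lt_rowLen.1 hi
  have hj' := mem_iff_lt_rowLen.1 hj
  refine ⟨i, j, exists_of_rowsDefect hij ?_ ?_ fun k hkk => ?_⟩
  · rcases rowLen_succ_lt_or hi hid with h | ⟨h1, h2⟩
    · exact Or.inr h
    · by_cases h3 : i + 1 = j
      · exact Or.inl h3
      · have := hk _ h1 (by omega) h3
        omega
  · rcases rowLen_succ_lt_or hj hjd with h | ⟨h1, h2⟩
    · exact h
    · have := hk _ h1 (by omega) (by omega)
      omega
  · have hkd := hk k hkk
    have hk' := mem_iff_lt_rowLen.1 hkk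
    rw [defect, rowsDefect]
    by_cases h1 : k = i
    · subst h1
      split_ifs <;> omega
    · by_cases h2 : k = j
      · subst h2
        split_ifs <;> omega
      · have := hkd h1 h2
        split_ifs <;> omega

/-- The cells to remove are the end of row i and the bottom of column j. -/
theorem exists_of_neg_of_pos {i j : ℕ} (hij : i ≠ j) (hi : (i, i) ∈ μ) (hj : (j, j) ∈ μ)
    (hid : μ.colLen i = μ.rowLen i) (hjd : μ.colLen j = μ.rowLen j + 2)
    (hjc : μ.IsCorner (μ.colLen j - 1, j))
    (hk : ∀ k, (k, k) ∈ μ → k ≠ i → k ≠ j → μ.colLen k = μ.rowLen k + 1) :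
    ∃ r s lam, RemovesRows lam μ r s ∧ lam.IsThreshold := by
  have hi' := mem_iff_lt_rowLen.1 hi
  have hj' := mem_iff_lt_rowLen.1 hj
  have hc := (isCorner_bottom_iff hj).1 hjc
  have h2 := lt_rowLen_iff_lt_colLen (μ := μ) (i := μ.colLen j - 1 + 1) (j := j)
  have hlt : i < μ.colLen j - 1 := by
    have h3 := lt_rowLen_iff_lt_colLen (μ := μ) (i := i) (j := i)
    have h4 := lt_rowLen_iff_lt_colLen (μ := μ) (i := j) (j := i)
    have h5 := lt_rowLen_iff_lt_colLen (μ := μ) (i := i) (j := j)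
    omega
  refine ⟨i, μ.colLen j - 1, exists_of_rowsDefect hlt ?_ (by omega) fun k hkk => ?_⟩
  · rcases rowLen_succ_lt_or hi hid with h | ⟨h1, h2⟩
    · exact Or.inr h
    · by_cases h3 : i + 1 = j
      · subst h3
        omega
      · have := hk _ h1 (by omega) h3
        omega
  · have hkd := hk k hkk
    have hk' := mem_iff_lt_rowLen.1 hkk
    rw [defect, rowsDefect, hc]
    by_cases h1 : k = i
    · subst h1
      split_ifs <;> omega
    · by_cases h2 : k = j
      · subst h2
        split_ifs <;> omega
      · have := hkd h1 h2
        split_ifs <;> omega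

theorem exists_of_two_pos {i j : ℕ} (hij : i < j) (hi : (i, i) ∈ μ) (hj : (j, j) ∈ μ)
    (hid : μ.colLen i = μ.rowLen i + 2) (hic : μ.IsCorner (μ.colLen i - 1, i))
    (hjd : μ.colLen j = μ.rowLen j + 2) (hjc : μ.IsCorner (μ.colLen j - 1, j))
    (hk : ∀ k, (k, k) ∈ μ → k ≠ i → k ≠ j → μ.colLen k = μ.rowLen k + 1) :
    ∃ r s lam, RemovesRows lam μ r s ∧ lam.IsThreshold := by
  have hi' := mem_iff_lt_rowLen.1 hi
  have hj' := mem_iff_lt_rowLen.1 hj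
  have hci := (isCorner_bottom_iff hi).1 hic
  have hcj := (isCorner_bottom_iff hj).1 hjc
  have h1 := lt_rowLen_iff_lt_colLen (μ := μ) (i := μ.colLen i - 1 + 1) (j := i)
  have h2 := lt_rowLen_iff_lt_colLen (μ := μ) (i := μ.colLen j - 1 + 1) (j := j)
  have h3 := lt_rowLen_iff_lt_colLen (μ := μ) (i := μ.colLen i - 1) (j := j)
  -- The order of the rows is reversed: column `j` lies further right and ends higher.
  refine ⟨μ.colLen j - 1, μ.colLen i - 1,
    exists_of_rowsDefect (by omega) (Or.inr (by omega)) (by omega) fun k hkk => ?_⟩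
  have hkd := hk k hkk
  have hk' := mem_iff_lt_rowLen.1 hkk
  rw [defect, rowsDefect, hci, hcj]
  by_cases h1 : k = i
  · subst h1
    split_ifs <;> omega
  · by_cases h2 : k = j
    · subst h2
      split_ifs <;> omega
    · have := hkd h1 h2
      split_ifs <;> omega

theorem exists_of_defect_two {i : ℕ} (hi : (i, i) ∈ μ)
    (hid : μ.colLen i = μ.rowLen i + 3)
    (hk : ∀ k, (k, k) ∈ μ → k ≠ i → μ.colLen k = μ.rowLen k + 1) :
    ∃ r s lam, RemovesRows lam μ r s ∧ lam.IsThreshold := by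
  have hi' := mem_iff_lt_rowLen.1 hi
  have h1 := lt_rowLen_iff_lt_colLen (μ := μ) (i := μ.colLen i) (j := i)
  have h2 := lt_rowLen_iff_lt_colLen (μ := μ) (i := μ.colLen i - 1) (j := i)
  have h3 := lt_rowLen_iff_lt_colLen (μ := μ) (i := μ.colLen i - 2) (j := i)
  have h4 := μ.rowLen_anti (μ.colLen i - 2) (μ.colLen i - 1) (by omega)
  -- No corner condition is needed here. If this row reached column i + 1, that column would have
  -- length at least `μ.rowLen i + 2`, and the threshold condition at i + 1 would make row i + 1
  -- longer than row i.
  have hr : μ.rowLen (μ.colLen i - 2) = i + 1 := by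
    by_contra hne
    have h5 := lt_rowLen_iff_lt_colLen (μ := μ) (i := μ.colLen i - 2) (j := i + 1)
    have h6 := hk (i + 1) (mem_iff_lt_colLen.2 (by omega)) (by omega)
    have h7 := μ.rowLen_anti i (i + 1) (by omega)
    have h8 := μ.colLen_anti i (i + 1) (by omega)
    omega
  have hs : μ.rowLen (μ.colLen i - 1) = i + 1 := by omega
  refine ⟨μ.colLen i - 2, μ.colLen i - 1, exists_of_rowsDefect (by omega) (Or.inl (by omega))
    (by rw [show μ.colLen i - 1 + 1 = μ.colLen i by omega]; omega) fun k hkk => ?_⟩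
  have hkd := hk k hkk
  have hk' := mem_iff_lt_rowLen.1 hkk
  rw [defect, rowsDefect, hr, hs]
  by_cases h1 : k = i
  · subst h1
    split_ifs <;> omega
  · have := hkd h1
    split_ifs <;> omega

theorem IsNearThreshold.exists_removesRows (h : μ.IsNearThreshold) :
    ∃ r s lam, RemovesRows lam μ r s ∧ lam.IsThreshold := by
  rcases h with ⟨i, j, hij, hi, hj, hid, hjd, hk⟩ | ⟨i, hi, hid, hk⟩
  · wlog hlt : i < j generalizing i j with H
    · exact H j i hij.symm hj hi hjd hid (fun k hkk h1 h2 => hk k hkk h2 h1) (by omega)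
    have hk' : ∀ k, (k, k) ∈ μ → k ≠ j → k ≠ i → μ.colLen k = μ.rowLen k + 1 :=
      fun k hkk h1 h2 => hk k hkk h2 h1
    rcases hid with ⟨hid, hic⟩ | hid <;> rcases hjd with ⟨hjd, hjc⟩ | hjd
    · exact exists_of_two_pos hlt hi hj hid hic hjd hjc hk
    · exact exists_of_neg_of_pos hij.symm hj hi hjd hid hic hk'
    · exact exists_of_neg_of_pos hij hi hj hid hjd hjc hk
    · exact exists_of_two_neg hlt hi hj hid hjd hk
  · exact exists_of_defect_two hi hid hk

theorem IsNearThreshold.not_isThreshold (h : μ.IsNearThreshold) : ¬ μ.IsThreshold := by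
  intro hT
  rcases h with ⟨i, j, -, hi, -, hid, -, -⟩ | ⟨i, hi, hid, -⟩
  · have := hT i hi
    rcases hid with ⟨hid, -⟩ | hid <;> omega
  · have := hT i hi
    omega

end Existence

end YoungDiagram

/-! ### The removable strips of threshold partitions and their corners -/

namespace YoungDiagram

open Finset SymFun

/-- The rows above which a threshold partition can be shortened symmetrically. -/
def shortenable (μ : YoungDiagram) : Finset ℕ :=
  (range (μ.colLen 0)).filter fun i =>
    i < μ.rowLen i ∧ (μ.rowLen (i + 1) ≤ i + 1 ∨ μ.rowLen (i + 1) < μ.rowLen i)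

theorem mem_shortenable {μ : YoungDiagram} {i : ℕ} : i ∈ μ.shortenable ↔
    i < μ.rowLen i ∧ (μ.rowLen (i + 1) ≤ i + 1 ∨ μ.rowLen (i + 1) < μ.rowLen i) := by
  rw [shortenable, mem_filter, mem_range, and_iff_right_iff_imp]
  rintro ⟨h, -⟩
  have := lt_rowLen_iff_lt_colLen (μ := μ) (i := i) (j := 0)
  omega

/-- Otherwise columns i and i + 1 have equal length, hence so do rows i and i + 1, and (i + 1, i +
1) is a cell; this contradicts the choice of i. -/
theorem IsThreshold.rowLen_bottom {μ : YoungDiagram} (hμ : μ.IsThreshold) {i : ℕ}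
    (hi : i ∈ μ.shortenable) : μ.rowLen (μ.colLen i - 1) = i + 1 := by
  obtain ⟨h1, h2⟩ := mem_shortenable.1 hi
  have h3 := hμ i (mem_iff_lt_rowLen.2 h1)
  have h4 := lt_rowLen_iff_lt_colLen (μ := μ) (i := μ.colLen i - 1) (j := i)
  by_contra hne
  have h5 := lt_rowLen_iff_lt_colLen (μ := μ) (i := μ.colLen i - 1) (j := i + 1)
  have hmem : (i + 1, i + 1) ∈ μ := mem_iff_lt_colLen.2 (by omega)
  have h6 := hμ (i + 1) hmem
  have := mem_iff_lt_rowLen.1 hmem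
  omega

theorem IsThreshold.exists_removesRows {μ : YoungDiagram} (hμ : μ.IsThreshold) {i : ℕ}
    (hi : i ∈ μ.shortenable) :
    ∃ lam, RemovesRows lam μ i (μ.colLen i - 1) ∧ lam.IsThreshold := by
  have hb := hμ.rowLen_bottom hi
  obtain ⟨h1, h2⟩ := mem_shortenable.1 hi
  have h3 := hμ i (mem_iff_lt_rowLen.2 h1)
  have h4 := lt_rowLen_iff_lt_colLen (μ := μ) (i := μ.colLen i - 1 + 1) (j := i)
  refine exists_of_rowsDefect (by omega) ?_ (by omega) fun k hk => ?_
  · by_cases h5 : i + 1 = μ.colLen i - 1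
    · exact Or.inl h5
    · right
      omega
  · have h6 := hμ k hk
    have h7 := mem_iff_lt_rowLen.1 hk
    rw [defect, rowsDefect, hb]
    by_cases h8 : k = i
    · subst h8
      split_ifs <;> omega
    · split_ifs <;> omega

/-- All defects of μ vanish, so the contributions of the two cells must cancel: the first cell ends
row r on or right of the diagonal, and the second is the bottom of column r. -/
theorem RemovesRows.mem_shortenable {lam μ : YoungDiagram} {r s : ℕ} (h : RemovesRows lam μ r s)
    (hlam : lam.IsThreshold) (hμ : μ.IsThreshold) :
    r ∈ μ.shortenable ∧ s = μ.colLen r - 1 := by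
  have hF := h.isThreshold_iff.1 hlam
  have hlt := h.lt
  have hle := μ.rowLen_anti r s hlt.le
  have hs0 := h.right
  have hr0 := h.left
  have hF0 : ∀ k, (k, k) ∈ μ → μ.rowsDefect r s k = 0 := fun k hk => by
    rw [← hF k hk, defect_eq_zero_iff]
    exact hμ k hk
  simp only [rowsDefect] at hF0
  have hr : r < μ.rowLen r := by
    by_contra hr
    obtain ⟨c, hc⟩ : ∃ c, c + 1 = μ.rowLen s := ⟨μ.rowLen s - 1, by omega⟩
    have hcc := h.colLen_of_succ_eq_right hc
    have := hF0 c (mem_iff_lt_colLen.2 (by omega))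
    split_ifs at this <;> omega
  have hrs : r + 1 = μ.rowLen s := by
    have := hF0 r (mem_iff_lt_rowLen.2 hr)
    split_ifs at this <;> omega
  have hcc := h.colLen_of_succ_eq_right hrs
  refine ⟨YoungDiagram.mem_shortenable.2 ⟨hr, ?_⟩, by omega⟩
  by_cases hs : r + 1 = s
  · left
    rw [hs, ← hrs, hs]
  · right
    have h1 := h.other (r + 1) (by omega) hs
    have h2 := lam.rowLen_anti r (r + 1) (by omega)
    omega

open Classical in
/-- The number of threshold partitions below `μ` for which the skew diagram is a vertical strip. -/
noncomputable def thresholdCount (n : ℕ) (μ : YoungDiagram) : ℕ :=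
  ((thresholdPartitions n).filter fun lam => IsVerticalStrip lam μ).card

theorem thresholdCount_of_isThreshold {n : ℕ} {μ : YoungDiagram} (hc : μ.card = n + 2)
    (hμ : μ.IsThreshold) : thresholdCount n μ = μ.shortenable.card := by
  classical
  symm
  have hex : ∀ i ∈ μ.shortenable, ∃ lam, RemovesRows lam μ i (μ.colLen i - 1) ∧ lam.IsThreshold :=
    fun i hi => hμ.exists_removesRows hi
  choose f hf hfT using hex
  refine card_bij f (fun i hi => ?_) (fun i hi j hj hij => ?_) fun lam hlam => ?_
  · rw [mem_filter, mem_thresholdPartitions]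
    have := (hf i hi).card_eq
    exact ⟨⟨by omega, hfT i hi⟩, (hf i hi).isVerticalStrip⟩
  · have h1 := hf i hi
    have h2 := hf j hj
    rw [← hij] at h2
    have h3 := h1.rowLen_eq i
    have h4 := h1.rowLen_eq j
    have h5 := h2.rowLen_eq i
    have h6 := h2.rowLen_eq j
    have h7 := h1.lt
    have h8 := h2.lt
    simp only [true_or, if_true] at h3 h6
    split_ifs at h4 h5 <;> omega
  · rw [mem_filter, mem_thresholdPartitions] at hlam
    obtain ⟨⟨h1, h2⟩, h3⟩ := hlam
    obtain ⟨r, s, hrs⟩ := YoungDiagram.exists_removesRows h3 (by omega)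
    obtain ⟨hr, rfl⟩ := hrs.mem_shortenable h2 hμ
    exact ⟨r, hr, (hf r hr).eq_of_rows hrs⟩

theorem thresholdCount_of_isNearThreshold {n : ℕ} {μ : YoungDiagram} (hc : μ.card = n + 2)
    (hμ : μ.IsNearThreshold) : thresholdCount n μ = 1 := by
  classical
  obtain ⟨r, s, lam, h, hlam⟩ := hμ.exists_removesRows
  refine card_eq_one.2 ⟨lam, ?_⟩
  ext ρ
  rw [mem_filter, mem_thresholdPartitions, mem_singleton]
  constructor
  · rintro ⟨⟨h1, h2⟩, h3⟩
    obtain ⟨r', s', h'⟩ := YoungDiagram.exists_removesRows h3 (by omega)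
    exact h'.unique h h2 hlam hμ.not_isThreshold
  · rintro rfl
    have := h.card_eq
    exact ⟨⟨by omega, hlam⟩, h.isVerticalStrip⟩

theorem thresholdCount_eq_zero {n : ℕ} {μ : YoungDiagram} (hc : μ.card = n + 2)
    (h1 : ¬ μ.IsThreshold) (h2 : ¬ μ.IsNearThreshold) : thresholdCount n μ = 0 := by
  classical
  refine card_eq_zero.2 (filter_eq_empty_iff.2 fun lam hlam hstrip => ?_)
  rw [mem_thresholdPartitions] at hlam
  obtain ⟨r, s, h⟩ := YoungDiagram.exists_removesRows hstrip (by omega)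
  exact h2 (h.isNearThreshold hlam.2 h1)

open Classical in
theorem IsThreshold.card_lower_corners {μ : YoungDiagram} (hμ : μ.IsThreshold) :
    ((μ.cells.filter μ.IsCorner).filter fun c => c.2 < c.1).card = μ.shortenable.card := by
  symm
  refine card_bij (fun i _ => (μ.colLen i - 1, i)) (fun i hi => ?_) (fun i _ j _ hij => ?_)
    fun c hc => ?_
  · have h1 := hμ.rowLen_bottom hi
    have h2 := mem_iff_lt_rowLen.2 (mem_shortenable.1 hi).1
    have h3 := (isCorner_bottom_iff h2).2 h1
    have h4 := hμ i h2
    have := mem_iff_lt_rowLen.1 h2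
    rw [mem_filter, mem_filter, mem_cells]
    exact ⟨⟨h3.1, h3⟩, by simp only; omega⟩
  · exact (Prod.mk.inj hij).2
  · obtain ⟨s, i⟩ := c
    rw [mem_filter, mem_filter, mem_cells] at hc
    obtain ⟨⟨-, h1, h2, h3⟩, h4⟩ := hc
    simp only at h1 h2 h3 h4
    have hi : (i, i) ∈ μ := μ.up_left_mem h4.le le_rfl h1
    have h5 := hμ i hi
    rw [mem_iff_lt_colLen] at h1 h2 h3
    refine ⟨i, mem_shortenable.2 ⟨mem_iff_lt_rowLen.1 hi, ?_⟩, Prod.ext (by simp only; omega) rfl⟩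
    by_contra hcon
    have h6 := hμ (i + 1) (mem_iff_lt_rowLen.2 (by omega))
    omega

-- A threshold partition has no corner on the diagonal, because column i is longer than row i. This
-- explains the bound `i + 2`.
open Classical in
theorem IsThreshold.card_upper_corners {μ : YoungDiagram} (hμ : μ.IsThreshold) :
    ((μ.cells.filter μ.IsCorner).filter fun c => ¬ c.2 < c.1).card =
      (μ.shortenable.filter fun i => i + 2 ≤ μ.rowLen i).card := by
  symm
  refine card_bij (fun i _ => (i, μ.rowLen i - 1)) (fun i hi => ?_) (fun i _ j _ hij => ?_)
    fun c hc => ?_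
  · rw [mem_filter] at hi
    obtain ⟨h1, h2⟩ := mem_shortenable.1 hi.1
    rw [mem_filter, mem_filter, mem_cells]
    simp only [IsCorner, mem_iff_lt_rowLen]
    have := hi.2
    omega
  · exact (Prod.mk.inj hij).1
  · obtain ⟨i, c⟩ := c
    rw [mem_filter, mem_filter, mem_cells] at hc
    obtain ⟨⟨-, h1, h2, h3⟩, h4⟩ := hc
    simp only at h1 h2 h3 h4
    have hi : (i, i) ∈ μ := μ.up_left_mem le_rfl (not_lt.1 h4) h1
    have h5 := hμ i hi
    have h6 := lt_rowLen_iff_lt_colLen (μ := μ) (i := i + 1) (j := i)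
    rw [mem_iff_lt_rowLen] at h1 h2 h3
    have h7 := mem_iff_lt_rowLen.1 hi
    refine ⟨i, mem_filter.2 ⟨mem_shortenable.2 ⟨h7, ?_⟩, ?_⟩, Prod.ext rfl (by simp only; omega)⟩
    · omega
    · omega

/-- Each shortenable i gives a corner below the diagonal and, unless row i ends on the diagonal, one
above it. The exception occurs at most once, so b is 2m or 2m - 1 for m shortenable rows. The
formula also holds for the empty partition, where both sides are -1. -/
theorem IsThreshold.floor_numCorners {μ : YoungDiagram} (hμ : μ.IsThreshold) :
    ⌊((μ.numCorners : ℚ) - 1) / 2⌋ = (μ.shortenable.card : ℤ) - 1 := by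
  classical
  have h1 : μ.numCorners = μ.shortenable.card +
      (μ.shortenable.filter fun i => i + 2 ≤ μ.rowLen i).card := by
    rw [← hμ.card_lower_corners, ← hμ.card_upper_corners, card_filter_add_card_filter_not,
      numCorners]
  have h2 := card_filter_add_card_filter_not (s := μ.shortenable)
    (fun i => i + 2 ≤ μ.rowLen i)
  have h3 : (μ.shortenable.filter fun i => ¬ i + 2 ≤ μ.rowLen i).card ≤ 1 := by
    rw [card_le_one]
    have key : ∀ i j, i ∈ μ.shortenable.filter (fun i => ¬ i + 2 ≤ μ.rowLen i) →
        j ∈ μ.shortenable.filter (fun i => ¬ i + 2 ≤ μ.rowLen i) → ¬ i < j := by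
      intro i j hi hj hij
      rw [mem_filter, mem_shortenable] at hi hj
      have := μ.rowLen_anti i j hij.le
      omega
    intro i hi j hj
    have := key i j hi hj
    have := key j i hj hi
    omega
  rw [Int.floor_eq_iff]
  have h4 : (μ.numCorners : ℚ) ≤ 2 * μ.shortenable.card := by exact_mod_cast (by omega)
  have h5 : 2 * (μ.shortenable.card : ℚ) ≤ μ.numCorners + 1 := by exact_mod_cast (by omega)
  push_cast
  constructor <;> linarith

open Classical in
theorem thresholdCount_eq {n : ℕ} {μ : YoungDiagram} (hc : μ.card = n + 2) :
    (thresholdCount n μ : ℤ) = (if μ.IsNearThreshold then 1 else 0) +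
      if μ.IsThreshold then 1 + ⌊((μ.numCorners : ℚ) - 1) / 2⌋ else 0 := by
  by_cases h1 : μ.IsThreshold
  · rw [if_pos h1, if_neg (fun h2 => h2.not_isThreshold h1), h1.floor_numCorners,
      thresholdCount_of_isThreshold hc h1]
    ring
  · rw [if_neg h1]
    by_cases h2 : μ.IsNearThreshold
    · rw [if_pos h2, thresholdCount_of_isNearThreshold hc h2]
      simp
    · rw [if_neg h2, thresholdCount_eq_zero hc h1 h2]
      simp

end YoungDiagram

/-! ### Assembling the two expansions over ℚ -/

namespace SymFun

open Finset YoungDiagram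

theorem plethysmHom_X_one (g : SymFun ℚ) : plethysmHom g (MvPolynomial.X 1) = g := by
  rw [plethysmHom, MvPolynomial.aeval_X, powerPlethysm]
  have : (fun k : ℕ+ => 1 * k) = id := funext fun k => one_mul k
  rw [this, MvPolynomial.rename_id_apply]

theorem elem_two_mul_plethysmHom_elem (h : ℕ) :
    elem 2 * plethysmHom (elem 2) (elem h) =
      ∑ μ ∈ partitionsOf (2 * (h + 1)), thresholdCount (2 * h) μ • schur ℚ μ := by
  classical
  rw [plethysmHom_elem, mul_sum]
  simp only [elem_mul_schur]
  rw [sum_comm' (t' := partitionsOf (2 * (h + 1)))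
    (s' := fun μ => (thresholdPartitions (2 * h)).filter fun lam => IsVerticalStrip lam μ)]
  · refine sum_congr rfl fun μ _ => ?_
    rw [sum_const, thresholdCount]
  · intro lam μ
    simp only [mem_filter, mem_partitionsOf, mem_thresholdPartitions]
    constructor
    · rintro ⟨⟨h1, h2⟩, h3, h4⟩
      exact ⟨⟨⟨h1, h2⟩, h4⟩, by omega⟩
    · rintro ⟨⟨⟨h1, h2⟩, h4⟩, h3⟩
      exact ⟨⟨h1, h2⟩, by omega, h4⟩

theorem plethysm_twoOnes_colTwo (k : ℕ) :
    plethysm (schur ℚ (twoOnes k)) (schur ℚ colTwo) =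
      (∑ μ ∈ nearThresholdPartitions (2 * (k + 2)), schur ℚ μ) +
        ∑ ν ∈ thresholdPartitions (2 * (k + 2)),
          ⌊((ν.numCorners : ℚ) - 1) / 2⌋ • schur ℚ ν := by
  classical
  rw [plethysm_eq, schur_colTwo, schur_twoOnes, map_sub, map_mul, elem_one, plethysmHom_X_one,
    mul_comm, elem_two_mul_plethysmHom_elem, plethysmHom_elem, sub_eq_iff_eq_add,
    nearThresholdPartitions, thresholdPartitions, sum_filter, sum_filter, sum_filter,
    ← sum_add_distrib, ← sum_add_distrib]
  refine sum_congr rfl fun μ hμ => ?_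
  rw [← natCast_zsmul, thresholdCount_eq (by have := mem_partitionsOf.1 hμ; omega)]
  split_ifs <;> simp [add_smul, add_comm]

/-- On generators, p_r[h_2] = (p_r² + p_{2r})/2, and ω changes the sign of p_{2r} but not of p_r².
No ω acts on f because the inner function has even degree. -/
theorem omega_plethysmHom_rowTwo (f : SymFun ℚ) :
    omega (plethysmHom (schur ℚ rowTwo) f) = plethysmHom (schur ℚ colTwo) f := by
  have h0 : schur ℚ rowTwo = complete ℚ 2 := by
    rw [← transpose_colTwo, ← omega_schur, schur_colTwo, omega_elem]
  have key : omega.comp (plethysmHom (schur ℚ rowTwo)) = plethysmHom (schur ℚ colTwo) := by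
    ext r : 1
    rw [AlgHom.comp_apply, plethysmHom, plethysmHom, MvPolynomial.aeval_X, MvPolynomial.aeval_X,
      h0, schur_colTwo]
    have h2 : (2 : SymFun ℚ) ≠ 0 := two_ne_zero
    apply mul_left_cancel₀ h2
    have h3 : (2 : SymFun ℚ) * powerPlethysm r (complete ℚ 2) =
        MvPolynomial.X r ^ 2 + MvPolynomial.X (r * 2) := by
      have h4 := congrArg omega two_mul_elem_two
      have e1 : omega (MvPolynomial.X 1) = MvPolynomial.X 1 := by
        simpa [show Nat.succPNat 0 = 1 from rfl] using omega_X 0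
      have e2 : omega (MvPolynomial.X 2) = -MvPolynomial.X 2 := by
        simpa [show Nat.succPNat 1 = 2 from rfl] using omega_X 1
      rw [map_mul, map_ofNat, omega_elem, map_sub, map_pow, e1, e2, sub_neg_eq_add] at h4
      have h5 := congrArg (powerPlethysm r) h4
      simp only [powerPlethysm, map_mul, map_add, map_pow, MvPolynomial.rename_X, mul_one,
        map_ofNat] at h5
      exact h5
    rw [two_mul_powerPlethysm_elem_two]
    have h6 := congrArg omega h3
    rw [map_mul, map_ofNat, map_add, map_pow] at h6
    rw [h6, omega, MvPolynomial.aeval_X, MvPolynomial.aeval_X, mul_pow, ← pow_mul,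
      PNat.mul_coe, PNat.val_ofNat, pow_succ _ ((r : ℕ) * 2), pow_mul' _ (r : ℕ) 2, pow_mul']
    simp [sub_eq_add_neg]
  exact DFunLike.congr_fun key f

theorem plethysm_twoOnes_rowTwo (k : ℕ) :
    plethysm (schur ℚ (twoOnes k)) (schur ℚ rowTwo) =
      (∑ μ ∈ nearThresholdPartitions (2 * (k + 2)), schur ℚ μ.transpose) +
        ∑ ν ∈ thresholdPartitions (2 * (k + 2)),
          ⌊((ν.numCorners : ℚ) - 1) / 2⌋ • schur ℚ ν.transpose := by
  have h := congrArg omega (plethysm_twoOnes_colTwo k)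
  rw [plethysm_eq, ← omega_plethysmHom_rowTwo, omega_omega, ← plethysm_eq] at h
  simpa only [map_add, map_sum, map_zsmul, omega_schur] using h

/-! ### Passage from ℚ to K -/

section BaseChange

variable {K : Type*} [CommRing K] [Algebra ℚ K]

theorem map_complete (n : ℕ) :
    MvPolynomial.map (algebraMap ℚ K) (complete ℚ n) = complete K n := by
  refine map_complete_eq (MvPolynomial.map (algebraMap ℚ K)) (complete K) (complete_zero K)
    (fun n => ?_) n
  simpa using succ_mul_complete K n

theorem map_schur (μ : YoungDiagram) :
    MvPolynomial.map (algebraMap ℚ K) (schur ℚ μ) = schur K μ := by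
  rw [schur, schur, RingHom.map_det]
  congr 1
  ext1 i j
  simp only [RingHom.mapMatrix_apply, Matrix.map_apply, Matrix.of_apply]
  split_ifs
  · exact map_complete _
  · simp

theorem plethysm_map (f g : SymFun ℚ) :
    plethysm (MvPolynomial.map (algebraMap ℚ K) f) g =
      MvPolynomial.map (algebraMap ℚ K) (plethysm f g) := by
  rw [plethysm_eq, plethysm, plethysmHom, MvPolynomial.aeval_map_algebraMap]
  induction f using MvPolynomial.induction_on with
  | C a =>
    rw [MvPolynomial.aeval_C, MvPolynomial.aeval_C, MvPolynomial.algebraMap_eq, MvPolynomial.map_C]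
    rfl
  | add p q hp hq => rw [map_add, map_add, map_add, hp, hq]
  | mul_X p n hp => rw [map_mul, map_mul, map_mul, hp, MvPolynomial.aeval_X, MvPolynomial.aeval_X]

end BaseChange

end SymFun

theorem mainTheorem8 {K : Type*} [CommRing K] [Algebra ℚ K] (h : ℕ) (hh : 2 ≤ h) :
    SymFun.plethysm (SymFun.schur K (YoungDiagram.twoOnes (h - 2)))
        (SymFun.schur ℚ YoungDiagram.colTwo) =
      (∑ μ ∈ YoungDiagram.nearThresholdPartitions (2 * h), SymFun.schur K μ) +
        ∑ ν ∈ YoungDiagram.thresholdPartitions (2 * h),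
          ⌊((ν.numCorners : ℚ) - 1) / 2⌋ • SymFun.schur K ν ∧
    SymFun.plethysm (SymFun.schur K (YoungDiagram.twoOnes (h - 2)))
        (SymFun.schur ℚ YoungDiagram.rowTwo) =
      (∑ μ ∈ YoungDiagram.nearThresholdPartitions (2 * h), SymFun.schur K μ.transpose) +
        ∑ ν ∈ YoungDiagram.thresholdPartitions (2 * h),
          ⌊((ν.numCorners : ℚ) - 1) / 2⌋ • SymFun.schur K ν.transpose := by
  obtain ⟨k, rfl⟩ := Nat.exists_eq_add_of_le' hh
  rw [Nat.add_sub_cancel, ← SymFun.map_schur (K := K), SymFun.plethysm_map, SymFun.plethysm_map,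
    SymFun.plethysm_twoOnes_colTwo, SymFun.plethysm_twoOnes_rowTwo]
  simp only [map_add, map_sum, map_zsmul, SymFun.map_schur, and_self]
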